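/- Let $q$ be an odd prime power and let $r\ge 4$ be even. Let $Q$ be a non-degenerate quadratic form on $\mathbb F_q^{\,r+1}$ with polar form $B(x,y)=Q(x+y)-Q(x)-Q(y)$, let $\Sigma=\mathrm{PG}(r,q)$ be embedded coordinatewise in $\mathrm{PG}(r,q^2)$, and let $\mathcal Q(r,q)=\{\langle v\rangle\in\Sigma : Q(v)=0\}$ be the associated parabolic quadric. Extend $B$ to a bilinear form on $\mathbb F_{q^2}^{\,r+1}$, let $\tau(x_0,\dots,x_r)=(x_0^q,\dots,x_r^q)$, and let $$\mathcal H(r,q^2)=\{\langle x\rangle\in \mathrm{PG}(r,q^2) : B(\tau(x),x)=0\},$$ the non-degenerate Hermitian variety whose unitary polarity is the product of the orthogonal polarity of $B$ and $\tau$. For a line $\ell$ of $\Sigma$, its extended line $\bar\ell$ is the line of $\mathrm{PG}(r,q^2)$ spanned by $\ell$. Let $G\cong\mathrm{PGO}(r+1,q)$ be the group of projectivities of $\Sigma$ induced by the similitudes of $Q$ (the invertible linear maps $g$ such that $Q\circ g=cQ$ for some $c\in\mathbb F_q^*$), regarded as a group of projectivities of $\mathrm{PG}(r,q^2)$. Then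 $G$ leaves $\mathcal H(r,q^2)$ invariant and has exactly four orbits on the points of $\mathcal H(r,q^2)$, namely: 1. $\mathcal Q(r,q)$; 2. $\mathcal O$, the set of points of $\mathrm{PG}(r,q^2)\setminus\Sigma$ lying on an extended line $\bar\ell$, where $\ell$ is a line of $\Sigma$ contained in $\mathcal Q(r,q)$; 3. $\mathcal E$, the set of points of $\mathcal H(r,q^2)$ lying on an extended line $\bar\ell$, where $\ell$ is a line of $\Sigma$ having no point in common with $\mathcal Q(r,q)$; 4. $\mathcal S$, the set of points of $\mathcal H(r,q^2)\setminus\mathcal Q(r,q)$ lying on an extended line $\bar\ell$, where $\ell$ is a line of $\Sigma$ meeting $\mathcal Q(r,q)$ in exactly two points. Moreover $|\mathcal S|=|\mathcal E|=q^{r-1}(q^r-1)/2$. -/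

import Mathlib

open scoped LinearAlgebra.Projectivization MatrixGroups

namespace ParabolicHermitian

noncomputable section

universe u v

variable {F : Type u} [Field F] {n : ℕ}

/-- The points of `PG(n - 1, F)` on the quadric `Q = 0`. -/
def quadric (Q : QuadraticForm F (Fin n → F)) : Set (ℙ F (Fin n → F)) :=
  {P | ∀ v ∈ P.submodule, Q v = 0}

/-- A submodule is a projective line when it has vector space dimension two. -/
def IsLine (l : Submodule F (Fin n → F)) : Prop := Module.finrank F l = 2

/-- The points of `PG(n - 1, F)` on a projective subspace. -/
def points (l : Submodule F (Fin n → F)) : Set (ℙ F (Fin n → F)) :=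
  {P | P ∈ l.projectivization}

/-- The group of similitudes of `Q`: invertible matrices multiplying `Q` by a nonzero scalar. -/
def similitudeGroup (Q : QuadraticForm F (Fin n → F)) : Subgroup (GL (Fin n) F) where
  carrier := {g | ∃ c : Fˣ, ∀ v, Q (g.1.mulVec v) = c * Q v}
  one_mem' := ⟨1, by simp⟩
  mul_mem' := by
    rintro a b ⟨c, hc⟩ ⟨d, hd⟩
    refine ⟨c * d, fun v => ?_⟩
    have h := hc (b.1.mulVec v)
    rw [Matrix.mulVec_mulVec] at h
    rw [Units.val_mul, h, hd, Units.val_mul, mul_assoc]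
  inv_mem' := by
    rintro a ⟨c, hc⟩
    refine ⟨c⁻¹, fun v => ?_⟩
    have h := hc ((a⁻¹).1.mulVec v)
    rw [Matrix.mulVec_mulVec, ← Units.val_mul, mul_inv_cancel, Units.val_one,
      Matrix.one_mulVec] at h
    rw [h, ← mul_assoc, Units.inv_mul, one_mul]

/-- `PGO(Q)`: the projectivities of `PG(n - 1, F)` induced by the similitudes of `Q`. -/
def PGO (Q : QuadraticForm F (Fin n → F)) : Subgroup PGL(n, F) :=
  (similitudeGroup Q).map Matrix.ProjGenLinGroup.mk

variable (K : Type v) [Field K] [Algebra F K]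

/-- Coordinatewise inclusion of `F ^ n` into `K ^ n`, semilinear over `F → K`. -/
def incl : (Fin n → F) →ₛₗ[algebraMap F K] (Fin n → K) where
  toFun v i := algebraMap F K (v i)
  map_add' x y := by ext i; simp
  map_smul' c x := by ext i; simp

theorem incl_injective : Function.Injective (incl (F := F) (n := n) K) := by
  intro x y h
  ext i
  exact (algebraMap F K).injective (congrFun h i)

/-- The embedding of `PG(n - 1, F)` in `PG(n - 1, K)`. -/
def embed : ℙ F (Fin n → F) → ℙ K (Fin n → K) :=
  Projectivization.map (incl K) (incl_injective K)

/-- The subspace of `PG(n - 1, K)` extending a subspace of `PG(n - 1, F)`. -/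
def extend (l : Submodule F (Fin n → F)) : Submodule K (Fin n → K) :=
  Submodule.span K (incl K '' (l : Set (Fin n → F)))

variable (F n) in
/-- A projectivity of `PG(n - 1, F)`, considered as a projectivity of `PG(n - 1, K)`. -/
def extendPGL : PGL(n, F) →* PGL(n, K) :=
  Matrix.ProjGenLinGroup.lift
    (Matrix.ProjGenLinGroup.mk.comp (Matrix.GeneralLinearGroup.map (algebraMap F K))) (by
      ext c
      have h : Matrix.GeneralLinearGroup.map (algebraMap F K)
          (Matrix.GeneralLinearGroup.scalar (Fin n) c) =
          Matrix.GeneralLinearGroup.scalar (Fin n) (Units.map (algebraMap F K).toMonoidHom c) := by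
        ext i j
        by_cases hij : i = j
        · subst hij
          simp [Matrix.GeneralLinearGroup.map, Matrix.GeneralLinearGroup.scalar]
        · simp [Matrix.GeneralLinearGroup.map, Matrix.GeneralLinearGroup.scalar, hij]
      simp [h])

/-- The group `G`: `PGO(Q)` considered as a group of projectivities of `PG(n - 1, K)`. -/
def groupG (Q : QuadraticForm F (Fin n → F)) : Subgroup PGL(n, K) :=
  (PGO Q).map (extendPGL F n K)

/-- The `K`-bilinear extension to `K ^ n` of the polar form `Q (x + y) - Q x - Q y`. -/
def polarExt (Q : QuadraticForm F (Fin n → F)) : LinearMap.BilinForm K (Fin n → K) :=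
  Matrix.toBilin' ((LinearMap.BilinForm.toMatrix' Q.polarBilin).map (algebraMap F K))

variable (F) in
/-- The map `τ`, raising each coordinate to the power `q = |F|`. When `|K| = q ^ 2`, this induces
the semilinear involution of `PG(n - 1, K)` fixing `PG(n - 1, F)` pointwise. -/
def tau (x : Fin n → K) : Fin n → K := fun i => x i ^ Nat.card F

/-- The Hermitian form `h (x, y) = B (τ x, y)`, with `B` the polar form of `Q` over `K`. Its
polarity is `τ` followed by the orthogonal polarity of `Q`. -/
def hermForm (Q : QuadraticForm F (Fin n → F)) (x y : Fin n → K) : K :=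
  polarExt K Q (tau F K x) y

/-- The Hermitian variety of the form `hermForm`. -/
def hermitian (Q : QuadraticForm F (Fin n → F)) : Set (ℙ K (Fin n → K)) :=
  {P | ∀ v ∈ P.submodule, hermForm K Q v v = 0}

/-- The quadric `Q = 0` of `PG(n - 1, F)`, as a set of points of `PG(n - 1, K)`. -/
def setQ (Q : QuadraticForm F (Fin n → F)) : Set (ℙ K (Fin n → K)) :=
  embed K '' quadric Q

/-- Points outside `PG(n - 1, F)` on extended lines of the quadric. -/
def setO (Q : QuadraticForm F (Fin n → F)) : Set (ℙ K (Fin n → K)) :=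
  {P | P ∉ Set.range (embed (F := F) (n := n) K) ∧
    ∃ l, IsLine l ∧ points l ⊆ quadric Q ∧ P ∈ points (extend K l)}

/-- Points of the Hermitian variety on extended lines of `PG(n - 1, F)` external to the quadric. -/
def setE (Q : QuadraticForm F (Fin n → F)) : Set (ℙ K (Fin n → K)) :=
  {P | P ∈ hermitian K Q ∧
    ∃ l, IsLine l ∧ points l ∩ quadric Q = ∅ ∧ P ∈ points (extend K l)}

/-- Points of the Hermitian variety off the quadric of `PG(n - 1, F)`, on extended lines
of `PG(n - 1, F)` meeting that quadric in exactly two points. -/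
def setS (Q : QuadraticForm F (Fin n → F)) : Set (ℙ K (Fin n → K)) :=
  {P | P ∈ hermitian K Q \ setQ K Q ∧
    ∃ l, IsLine l ∧ (points l ∩ quadric Q).ncard = 2 ∧ P ∈ points (extend K l)}

end

end ParabolicHermitian

/-!
Fix a nonsquare `d` of `F` and `e` in `K` with `e ^ 2 = d`. A vector of `K ^ (r + 1)` is `u + e v`
with `u`, `v` over `F`, and its point is on the Hermitian variety iff `Q u = d * Q v`. If `u` and
`v` are dependent, the point is in `𝒬`; otherwise it lies on just one extended line, that of
`⟨u, v⟩`, which is contained in the quadric, secant or external according as the discriminant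
`B(u, v) ^ 2 - 4 * Q u * Q v` is zero, a nonzero square or a nonsquare. (If it is zero, then
`Q u = d * Q v` gives `B(u, v) ^ 2 = 4 * d * Q v ^ 2`, so that `Q` vanishes on `⟨u, v⟩`.)

On the variety, `x = u + e v` satisfies: `B(x, x)` determines `Q u`, `Q v` and `B(u, v)`, and
`2 * e * B(x, x)` is a square of `K` iff the discriminant is a square of `F`. Since `B(x, x)` is
multiplied by a square when `x` is rescaled, two points of the same type have representatives with
the same `B(x, x)`, and Witt's theorem provides an isometry between them.

Each point of `𝒮` has exactly two representatives with `B(x, x) = 2 * e`, and these correspond to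
the pairs of singular vectors with polar form `1`. Quadratic Gauss sums count these pairs, and also
the pairs with `Q u = d * Q v`; the latter count gives `|ℰ|` from `|𝒮|`.
-/

namespace ParabolicHermitian

section GaussSum

open Finset

variable {F V V' R : Type*} [Field F] [AddCommGroup V] [Module F V] [AddCommGroup V'] [Module F V']
  [CommRing R]

theorem ringChar_ne_two (h2 : (2 : F) ≠ 0) : ringChar F ≠ 2 := fun h =>
  h2 (by exact_mod_cast h ▸ ringChar.Nat.cast_ringChar (R := F))

theorem ne_zero_of_not_isSquare {d : F} (hd : ¬IsSquare d) : d ≠ 0 :=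
  fun h => hd (h ▸ IsSquare.zero)

theorem card_filter_mul_sq_eq [Fintype F] [DecidableEq F] (h2 : (2 : F) ≠ 0) {a : F} (ha : a ≠ 0)
    (c : F) : (#{x : F | a * x ^ 2 = c} : ℤ) = 1 + quadraticChar F (a * c) := by
  have hχ : quadraticChar F (a⁻¹ ^ 2 * (a * c)) = quadraticChar F (a * c) := by
    rw [map_mul, quadraticChar_sq_one' (inv_ne_zero ha), one_mul]
  rw [add_comm, ← hχ, ← quadraticChar_card_sqrts (ringChar_ne_two h2)]
  congr 2
  ext x
  simp only [mem_filter, mem_univ, true_and, Set.mem_toFinset, Set.mem_ofPred_eq]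
  field_simp

theorem sum_apply_mul_sq [Fintype F] [DecidableEq F] (h2 : (2 : F) ≠ 0) {a : F} (ha : a ≠ 0)
    (f : F → R) : ∑ x, f (a * x ^ 2) = ∑ c, ((1 + quadraticChar F (a * c) : ℤ) : R) * f c := by
  rw [← sum_fiberwise (s := univ) (g := fun x : F => a * x ^ 2)]
  refine sum_congr rfl fun c _ => ?_
  rw [← card_filter_mul_sq_eq h2 ha c, Int.cast_natCast, ← nsmul_eq_mul, ← sum_const]
  exact sum_congr rfl fun x hx => by rw [(mem_filter.1 hx).2]

theorem sum_addChar_mul_sq_of_not_isSquare [Fintype F] [IsDomain R] (h2 : (2 : F) ≠ 0)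
    {ψ : AddChar F R} (hψ : ψ ≠ 1) {d : F} (hd : ¬IsSquare d) {a : F} (ha : a ≠ 0) :
    ∑ x, ψ (d * (a * x ^ 2)) = -∑ x, ψ (a * x ^ 2) := by
  classical
  have hχ (c : F) : quadraticChar F (d * a * c) = -quadraticChar F (a * c) := by
    rw [mul_assoc, map_mul, quadraticChar_neg_one_iff_not_isSquare.2 hd, neg_one_mul]
  simp only [← mul_assoc]
  rw [eq_neg_iff_add_eq_zero, sum_apply_mul_sq h2 (mul_ne_zero (ne_zero_of_not_isSquare hd) ha),
    sum_apply_mul_sq h2 ha, ← sum_add_distrib, ← mul_zero 2, ← AddChar.sum_eq_zero_of_ne_one hψ,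
    mul_sum]
  refine sum_congr rfl fun c _ => ?_
  rw [hχ]
  push_cast
  ring

/-- The Gauss sum of the quadratic form `Q` with respect to the additive character `ψ`. Its value
at the multiple `a • Q` of `Q` is written with the shifted character `ψ.mulShift a`. -/
def quadraticGaussSum [Fintype V] (ψ : AddChar F R) (Q : QuadraticForm F V) : R := ∑ x, ψ (Q x)

theorem quadraticGaussSum_congr [Fintype V] [Fintype V'] {Q : QuadraticForm F V}
    {Q' : QuadraticForm F V'} (e : Q.IsometryEquiv Q') (ψ : AddChar F R) :
    quadraticGaussSum ψ Q = quadraticGaussSum ψ Q' :=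
  Fintype.sum_equiv e.toEquiv _ _ fun x => congrArg ψ (e.map_app x).symm

theorem quadraticGaussSum_weightedSumSquares [Fintype F] {ι : Type*} [Fintype ι] [DecidableEq ι]
    (ψ : AddChar F R) (w : ι → Fˣ) :
    quadraticGaussSum ψ (QuadraticMap.weightedSumSquares F w) =
      ∏ i, ∑ x, ψ (w i * x ^ 2) := by
  rw [prod_univ_sum, Fintype.piFinset_univ]
  refine sum_congr rfl fun x _ => ?_
  simp only [QuadraticMap.weightedSumSquares_apply, Units.smul_def, smul_eq_mul, ← sq]
  exact map_prod ψ.toMonoidHom _ _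

theorem quadraticGaussSum_mulShift_of_not_isSquare [Finite F] [Fintype V] [IsDomain R]
    (h2 : (2 : F) ≠ 0) {Q : QuadraticForm F V} (hQ : Q.polarBilin.Nondegenerate)
    (hV : Odd (Module.finrank F V)) {ψ : AddChar F R} (hψ : ψ ≠ 1) {d : F} (hd : ¬IsSquare d) :
    quadraticGaussSum (ψ.mulShift d) Q = -quadraticGaussSum ψ Q := by
  have := Fintype.ofFinite F
  let : Invertible (2 : F) := invertibleOfNonzero h2
  obtain ⟨w, ⟨e⟩⟩ := Q.equivalent_weightedSumSquares_units_of_nondegenerate'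
    (QuadraticMap.nondegenerate_associated_iff.2 (QuadraticMap.nondegenerate_polar_iff.1 hQ)).1
  rw [quadraticGaussSum_congr e, quadraticGaussSum_congr e, quadraticGaussSum_weightedSumSquares,
    quadraticGaussSum_weightedSumSquares]
  simp only [AddChar.mulShift_apply,
    sum_addChar_mul_sq_of_not_isSquare h2 hψ hd (Units.ne_zero (w _)), prod_neg, card_univ,
    Fintype.card_fin, hV.neg_one_pow, neg_one_mul]

theorem sum_addChar_apply_linearMap [Fintype V] [IsDomain R]
    {ψ : AddChar F R} (hψ : ψ ≠ 1) {f : V →ₗ[F] F} (hf : f ≠ 0) : ∑ x, ψ (f x) = 0 := by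
  obtain ⟨t, ht⟩ := AddChar.ne_one_iff.1 hψ
  obtain ⟨x, hx⟩ := LinearMap.surjective hf t
  exact AddChar.sum_eq_zero_of_ne_one (ψ := ψ.compAddMonoidHom f.toAddMonoidHom)
    (AddChar.ne_one_iff.2 ⟨x, by simpa [hx] using ht⟩)

theorem quadraticGaussSum_mul_mulShift_neg_one [Fintype V] [IsDomain R] {Q : QuadraticForm F V}
    (hQ : Q.polarBilin.Nondegenerate) {ψ : AddChar F R} (hψ : ψ ≠ 1) :
    quadraticGaussSum ψ Q * quadraticGaussSum (ψ.mulShift (-1)) Q = Fintype.card V := by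
  classical
  have hinner (z : V) : ∑ y, ψ (Q.polarBilin z y) = if z = 0 then (Fintype.card V : R) else 0 := by
    split_ifs with hz
    · simp [hz]
    · exact sum_addChar_apply_linearMap hψ fun h => hz (hQ.1 z fun y => by rw [h]; rfl)
  calc quadraticGaussSum ψ Q * quadraticGaussSum (ψ.mulShift (-1)) Q
      = ∑ y, ∑ x, ψ (Q x - Q y) := by
        simp only [quadraticGaussSum, sum_mul_sum, AddChar.mulShift_apply, neg_one_mul,
          ← AddChar.map_add_eq_mul, ← sub_eq_add_neg]
        exact sum_comm
    _ = ∑ y, ∑ z, ψ (Q z) * ψ (Q.polarBilin z y) := by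
        refine sum_congr rfl fun y _ => ?_
        rw [← Equiv.sum_comp (Equiv.addRight y)]
        refine sum_congr rfl fun z _ => ?_
        rw [← AddChar.map_add_eq_mul, Equiv.coe_addRight, QuadraticMap.map_add Q,
          QuadraticMap.polarBilin_apply_apply]
        ring_nf
    _ = Fintype.card V := by
        rw [sum_comm]
        simp only [← mul_sum, hinner]
        simp

theorem card_mul_card_zeros [Fintype F] [DecidableEq F] {X : Type*} [Fintype X] [IsDomain R]
    {ψ : AddChar F R} (hψ : ψ ≠ 1) (f : X → F) :
    (Fintype.card F * Nat.card {x // f x = 0} : R) =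
      Fintype.card X + ∑ t : Fˣ, ∑ x, ψ (t * f x) := by
  calc (Fintype.card F * Nat.card {x // f x = 0} : R)
      = ∑ x, ∑ t, ψ (t * f x) := by
        simp only [AddChar.sum_mulShift _ (AddChar.IsPrimitive.of_ne_one hψ), Nat.cast_ite,
          Nat.cast_zero, ← sum_filter, sum_const, nsmul_eq_mul, Nat.card_eq_fintype_card,
          Fintype.card_subtype, mul_comm]
    _ = Fintype.card X + ∑ t : Fˣ, ∑ x, ψ (t * f x) := by
        rw [sum_comm, ← add_sum_erase _ _ (mem_univ 0)]
        congr 1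
        · simp
        · exact (sum_bij (fun (t : Fˣ) _ => (t : F)) (by simp) (by simp [Units.ext_iff])
            (fun t ht => ⟨Units.mk0 t (ne_of_mem_erase ht), by simp⟩) (by simp)).symm

theorem mulShift_units_ne_one {ψ : AddChar F R} (hψ : ψ ≠ 1) (t : Fˣ) : ψ.mulShift t ≠ 1 :=
  AddChar.IsPrimitive.of_ne_one hψ t.ne_zero

theorem primitiveChar_to_Complex_ne_one [Finite F] :
    AddChar.FiniteField.primitiveChar_to_Complex F ≠ 1 := by
  simpa using AddChar.FiniteField.primitiveChar_to_Complex_isPrimitive F one_ne_zero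

theorem card_mul_card_isotropic [Finite F] [FiniteDimensional F V] (h2 : (2 : F) ≠ 0)
    {Q : QuadraticForm F V} (hQ : Q.polarBilin.Nondegenerate) (hV : Odd (Module.finrank F V)) :
    Nat.card F * Nat.card {x // Q x = 0} = Nat.card V := by
  classical
  have := Fintype.ofFinite F
  have := Module.finite_of_finite F (M := V)
  have := Fintype.ofFinite V
  have hψ := primitiveChar_to_Complex_ne_one (F := F)
  set ψ := AddChar.FiniteField.primitiveChar_to_Complex F
  obtain ⟨d, hd⟩ := FiniteField.exists_nonsquare (ringChar_ne_two h2)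
  have hsum : ∑ t : Fˣ, quadraticGaussSum (ψ.mulShift t) Q = 0 := by
    refine self_eq_neg.1 ?_
    conv_lhs => rw [← Equiv.sum_comp (Equiv.mulRight (Units.mk0 d (ne_zero_of_not_isSquare hd)))]
    simp only [Equiv.coe_mulRight, Units.val_mul, Units.val_mk0, ← AddChar.mulShift_mulShift,
      quadraticGaussSum_mulShift_of_not_isSquare h2 hQ hV (mulShift_units_ne_one hψ _) hd,
      sum_neg_distrib]
  have h := card_mul_card_zeros hψ fun x => Q x
  simp only [← AddChar.mulShift_apply] at h
  rw [Nat.card_eq_fintype_card, Nat.card_eq_fintype_card (α := V)]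
  exact_mod_cast h.trans ((congrArg _ hsum).trans (add_zero _))

theorem card_mul_card_pairs_eq_mul_add [Finite F] [FiniteDimensional F V] (h2 : (2 : F) ≠ 0)
    {Q : QuadraticForm F V} (hQ : Q.polarBilin.Nondegenerate) (hV : Odd (Module.finrank F V))
    {d : F} (hd : ¬IsSquare d) :
    Nat.card F * Nat.card {p : V × V // Q p.1 = d * Q p.2} + Nat.card Fˣ * Nat.card V =
      Nat.card V ^ 2 := by
  classical
  have := Fintype.ofFinite F
  have := Module.finite_of_finite F (M := V)
  have := Fintype.ofFinite V
  have hψ := primitiveChar_to_Complex_ne_one (F := F)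
  set ψ := AddChar.FiniteField.primitiveChar_to_Complex F
  have hterm (t : Fˣ) : ∑ p : V × V, ψ (t * (Q p.1 - d * Q p.2)) = -(Fintype.card V : ℂ) := by
    have ht := mulShift_units_ne_one hψ t
    calc ∑ p : V × V, ψ (t * (Q p.1 - d * Q p.2))
        = quadraticGaussSum (ψ.mulShift t) Q *
            quadraticGaussSum (((ψ.mulShift t).mulShift (-1)).mulShift d) Q := by
          simp only [quadraticGaussSum, sum_mul_sum, ← Fintype.sum_prod_type',
            AddChar.mulShift_apply, ← AddChar.map_add_eq_mul]
          refine sum_congr rfl fun p _ => congrArg ψ ?_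
          ring
      _ = -(Fintype.card V : ℂ) := by
          rw [quadraticGaussSum_mulShift_of_not_isSquare h2 hQ hV _ hd, mul_neg,
            quadraticGaussSum_mul_mulShift_neg_one hQ ht]
          exact (AddChar.IsPrimitive.of_ne_one ht) (neg_ne_zero.2 one_ne_zero)
  have h := card_mul_card_zeros hψ fun p : V × V => Q p.1 - d * Q p.2
  simp only [hterm, sub_eq_zero, sum_const, card_univ, nsmul_eq_mul, Fintype.card_prod] at h
  simp only [Nat.card_eq_fintype_card (α := V), Nat.card_eq_fintype_card (α := F),
    Nat.card_eq_fintype_card (α := Fˣ)]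
  refine Nat.cast_injective (R := ℂ) ?_
  push_cast at h ⊢
  linear_combination h

end GaussSum

section Witt

open QuadraticMap

universe u

variable {F : Type u} {V : Type*} [Field F] [AddCommGroup V] [Module F V] {Q : QuadraticForm F V}

theorem map_smul_add_smul (Q : QuadraticForm F V) (a b : F) (x y : V) :
    Q (a • x + b • y) = a ^ 2 * Q x + a * b * polar Q x y + b ^ 2 * Q y := by
  rw [QuadraticMap.map_add Q, QuadraticMap.map_smul, QuadraticMap.map_smul, polar_smul_left,
    polar_smul_right]
  simp only [smul_eq_mul]
  ring

theorem map_sub_smul (Q : QuadraticForm F V) (a : F) (x y : V) :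
    Q (x - a • y) = Q x - a * polar Q x y + a ^ 2 * Q y := by
  have h := map_smul_add_smul Q 1 (-a) x y
  rw [one_smul, neg_smul, ← sub_eq_add_neg] at h
  rw [h]
  ring

theorem polar_isometryEquiv (g : Q.IsometryEquiv Q) (x y : V) :
    polar Q (g x) (g y) = polar Q x y := by
  simp only [polar, ← map_add, g.map_app]

/-- The reflection of a quadratic space in the hyperplane orthogonal to an anisotropic vector. -/
def orthogonalReflection (Q : QuadraticForm F V) {x : V} (hx : Q x ≠ 0) : Q.IsometryEquiv Q where
  toLinearEquiv := Module.reflection (f := (Q x)⁻¹ • Q.polarBilin x) (x := x) (by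
    rw [LinearMap.smul_apply, polarBilin_apply_apply, polar_self, two_nsmul, smul_eq_mul, mul_add,
      inv_mul_cancel₀ hx, one_add_one_eq_two])
  map_app' y := by
    change Q (Module.reflection _ y) = Q y
    rw [Module.reflection_apply, LinearMap.smul_apply, map_sub_smul, polarBilin_apply_apply,
      polar_comm _ y x, smul_eq_mul]
    field

theorem orthogonalReflection_apply {x : V} (hx : Q x ≠ 0) (y : V) :
    orthogonalReflection Q hx y = y - ((Q x)⁻¹ * polar Q x y) • x :=
  rfl

theorem orthogonalReflection_apply_of_polar_eq_zero {x y : V} (hx : Q x ≠ 0)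
    (h : polar Q x y = 0) : orthogonalReflection Q hx y = y := by
  rw [orthogonalReflection_apply, h, mul_zero, zero_smul, sub_zero]

theorem orthogonalReflection_sub_apply_left {x y : V} (h : Q x = Q y) (hxy : Q (x - y) ≠ 0) :
    orthogonalReflection Q hxy x = y := by
  have hpolar : polar Q (x - y) x = Q (x - y) := by
    have h1 := map_sub_smul Q 1 x y
    rw [one_smul] at h1
    rw [polar_sub_left, polar_self, h1, polar_comm Q y x, two_nsmul, ← h]
    ring
  rw [orthogonalReflection_apply, hpolar, inv_mul_cancel₀ hxy, one_smul, sub_sub_cancel]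

theorem orthogonalReflection_apply_neg_self {x : V} (hx : Q x ≠ 0) :
    orthogonalReflection Q hx (-x) = x := by
  rw [orthogonalReflection_apply, polar_neg_right, polar_self, two_nsmul, mul_neg, mul_add,
    inv_mul_cancel₀ hx]
  module

theorem exists_isometryEquiv_apply_eq (h2 : (2 : F) ≠ 0) {x y : V} (hx : Q x ≠ 0) (h : Q x = Q y) :
    ∃ g : Q.IsometryEquiv Q, g x = y ∧ ∀ z, polar Q x z = 0 → polar Q y z = 0 → g z = z := by
  by_cases hsub : Q (x - y) = 0
  · have hy : Q y ≠ 0 := h ▸ hx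
    have hadd : Q (x - -y) ≠ 0 := fun hadd => by
      have h1 := map_sub_smul Q 1 x y
      have h2' := map_sub_smul Q (-1) x y
      rw [one_smul, hsub] at h1
      rw [neg_one_smul, hadd] at h2'
      refine mul_ne_zero (mul_ne_zero h2 h2) hx ?_
      linear_combination 2 * h - h1 - h2'
    refine ⟨(orthogonalReflection Q hadd).trans (orthogonalReflection Q hy), ?_,
      fun z hxz hyz => ?_⟩
    · change orthogonalReflection Q hy (orthogonalReflection Q hadd x) = y
      rw [orthogonalReflection_sub_apply_left (by rw [QuadraticMap.map_neg, h]),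
        orthogonalReflection_apply_neg_self]
    · change orthogonalReflection Q hy (orthogonalReflection Q hadd z) = z
      rw [orthogonalReflection_apply_of_polar_eq_zero hadd,
        orthogonalReflection_apply_of_polar_eq_zero hy hyz]
      rw [polar_sub_left, polar_neg_left, hxz, hyz, neg_zero, sub_zero]
  · refine ⟨orthogonalReflection Q hsub, orthogonalReflection_sub_apply_left h hsub,
      fun z hxz hyz => orthogonalReflection_apply_of_polar_eq_zero hsub ?_⟩
    rw [polar_sub_left, hxz, hyz, sub_zero]

theorem exists_isometryEquiv_apply_orthogonal_eq (h2 : (2 : F) ≠ 0) {k : ℕ} {a b : Fin k → V}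
    (ha : ∀ i, Q (a i) ≠ 0) (hab : ∀ i, Q (a i) = Q (b i))
    (ha' : Pairwise fun i j => polar Q (a i) (a j) = 0)
    (hb' : Pairwise fun i j => polar Q (b i) (b j) = 0) :
    ∃ g : Q.IsometryEquiv Q, ∀ i, g (a i) = b i := by
  induction k with
  | zero => exact ⟨.refl Q, fun i => i.elim0⟩
  | succ k ih =>
    obtain ⟨g, hg⟩ := ih (a := a ∘ Fin.castSucc) (b := b ∘ Fin.castSucc) (fun i => ha _)
      (fun i => hab _) (ha'.comp_of_injective (Fin.castSucc_injective k))
      (hb'.comp_of_injective (Fin.castSucc_injective k))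
    obtain ⟨g', hlast, hfix⟩ := exists_isometryEquiv_apply_eq h2 (Q := Q)
      (x := g (a (Fin.last k))) (y := b (Fin.last k)) (by rw [g.map_app]; exact ha _)
      (by rw [g.map_app]; exact hab _)
    refine ⟨g.trans g', fun i => ?_⟩
    change g' (g (a i)) = b i
    induction i using Fin.lastCases with
    | last => exact hlast
    | cast i =>
      have hi : g (a i.castSucc) = b i.castSucc := hg i
      rw [hi, hfix]
      · rw [← hi, polar_isometryEquiv]
        exact ha' (Fin.castSucc_lt_last i).ne'
      · exact hb' (Fin.castSucc_lt_last i).ne'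

theorem exists_isometryEquiv_comp_eq_of_radical_eq_bot (h2 : (2 : F) ≠ 0) {W : Type*}
    [AddCommGroup W] [Module F W] [FiniteDimensional F W] {f g : W →ₗ[F] V}
    (hfg : ∀ w, Q (f w) = Q (g w)) (hrad : (Q.comp f).radical = ⊥) :
    ∃ γ : Q.IsometryEquiv Q, ∀ w, γ (f w) = g w := by
  let : Invertible (2 : F) := invertibleOfNonzero h2
  have hnondeg : (Q.comp f).polarBilin.Nondegenerate :=
    nondegenerate_polar_iff.2 (nondegenerate_iff_radical_eq_bot.2 hrad)
  obtain ⟨v, hv⟩ := LinearMap.BilinForm.exists_orthogonal_basis (B := (Q.comp f).polarBilin)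
    ⟨fun x y => polar_comm _ x y⟩
  have hpolar (x y : W) : polar Q (f x) (f y) = polar Q (g x) (g y) := by
    simp only [polar, ← map_add, hfg]
  have horth : Pairwise fun i j => polar Q (f (v i)) (f (v j)) = 0 := fun i j hij => by
    simpa [Function.onFun, polarBilin_comp] using hv hij
  obtain ⟨γ, hγ⟩ := exists_isometryEquiv_apply_orthogonal_eq h2 (Q := Q) (a := f ∘ v) (b := g ∘ v)
    (fun i h => hv.not_isOrtho_basis_self_of_separatingLeft hnondeg.1 i (by
      rw [polarBilin_apply_apply, polar_self]
      exact (congrArg _ h).trans (smul_zero 2)))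
    (fun i => hfg _) horth fun i j hij => (hpolar _ _).symm.trans (horth hij)
  exact ⟨γ, LinearMap.congr_fun (v.ext hγ : γ.toLinearEquiv.toLinearMap ∘ₗ f = g)⟩

theorem exists_isotropic_polar_eq [FiniteDimensional F V] (hQ : Q.polarBilin.Nondegenerate)
    {W : Type*} [AddCommGroup W] [Module F W] {f : W →ₗ[F] V} (hf : Function.Injective f) {r : W}
    (hr : Q (f r) = 0) (hr' : ∀ w, polar Q (f w) (f r) = 0) {φ : Module.Dual F W}
    (hφ : φ r = 1) : ∃ y, Q y = 0 ∧ ∀ w, polar Q (f w) y = φ w := by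
  obtain ⟨l, hl⟩ := f.exists_leftInverse_of_injective (LinearMap.ker_eq_bot.2 hf)
  obtain ⟨y, hy⟩ := (LinearMap.BilinForm.toDual Q.polarBilin hQ).surjective (φ ∘ₗ l)
  have hpolar (w : W) : polar Q (f w) y = φ w := by
    rw [polar_comm]
    exact (LinearMap.congr_fun hy (f w)).trans (congrArg φ (LinearMap.congr_fun hl w))
  refine ⟨y - Q y • f r, ?_, fun w => ?_⟩
  · rw [map_sub_smul, polar_comm, hpolar, hφ, hr]
    ring
  · rw [polar_sub_right, polar_smul_right, hr', hpolar, smul_zero, sub_zero]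

theorem coprod_toSpanSingleton_injective {W : Type*} [AddCommGroup W] [Module F W]
    {f : W →ₗ[F] V} (hf : Function.Injective f) {x y : V} (hx : ∀ w, polar Q (f w) x = 0)
    (hxy : polar Q y x ≠ 0) :
    Function.Injective (f.coprod (LinearMap.toSpanSingleton F V y)) := by
  rw [injective_iff_map_eq_zero]
  rintro ⟨w, a⟩ h
  rw [LinearMap.coprod_apply, LinearMap.toSpanSingleton_apply] at h
  have ha : a = 0 := by
    have hpair : polar Q (f w + a • y) x = 0 := by rw [h, polar_zero_left]
    rw [polar_add_left, hx, zero_add, polar_smul_left, smul_eq_mul] at hpair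
    exact (mul_eq_zero.1 hpair).resolve_right hxy
  subst ha
  rw [zero_smul, add_zero] at h
  exact Prod.ext ((map_eq_zero_iff f hf).1 h) rfl

theorem apply_add_smul_of_isotropic {x y : V} (hy : Q y = 0) (a : F) :
    Q (x + a • y) = Q x + a * polar Q x y := by
  simpa [hy] using map_smul_add_smul Q 1 a x y

/-- Witt's extension theorem. A vector in the radical of `Q ∘ f` allows `f` and `g` to be extended
to `W × F`, whence the universe of `W`; once the radical is zero, reflections suffice. -/
theorem exists_isometryEquiv_comp_eq [FiniteDimensional F V] (h2 : (2 : F) ≠ 0)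
    (hQ : Q.polarBilin.Nondegenerate) {W : Type u} [AddCommGroup W] [Module F W]
    {f g : W →ₗ[F] V} (hf : Function.Injective f) (hg : Function.Injective g)
    (hfg : ∀ w, Q (f w) = Q (g w)) : ∃ γ : Q.IsometryEquiv Q, ∀ w, γ (f w) = g w := by
  induction hm : Module.finrank F V - Module.finrank F W using Nat.strong_induction_on
    generalizing W with
  | _ m ih =>
  have := FiniteDimensional.of_injective f hf
  by_cases hrad : (Q.comp f).radical = ⊥
  · exact exists_isometryEquiv_comp_eq_of_radical_eq_bot h2 hfg hrad
  obtain ⟨r, ⟨hr, hr'⟩, hr0⟩ := Submodule.exists_mem_ne_zero_of_ne_bot hrad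
  replace hr' (w : W) : polar Q (f w) (f r) = 0 := by
    rw [polar_comm]
    simpa [polarBilin_comp] using LinearMap.congr_fun hr' w
  obtain ⟨φ, hφ⟩ := Module.Projective.exists_dual_eq_one F hr0
  obtain ⟨y, hy, hfy⟩ := exists_isotropic_polar_eq hQ hf hr hr' hφ
  have hgr' (w : W) : polar Q (g w) (g r) = 0 := by
    simpa only [polar, ← map_add, hfg] using hr' w
  obtain ⟨z, hz, hgz⟩ := exists_isotropic_polar_eq hQ hg ((hfg r).symm.trans hr) hgr' hφ
  have hf' := coprod_toSpanSingleton_injective (y := y) hf hr'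
    (by rw [polar_comm, hfy, hφ]; exact one_ne_zero)
  have hg' := coprod_toSpanSingleton_injective (y := z) hg hgr'
    (by rw [polar_comm, hgz, hφ]; exact one_ne_zero)
  have hdim := LinearMap.finrank_le_finrank_of_injective hf'
  rw [Module.finrank_prod, Module.finrank_self] at hdim
  obtain ⟨γ, hγ⟩ := ih _ (by rw [Module.finrank_prod, Module.finrank_self]; omega) hf' hg'
    (fun p => by
      simp only [LinearMap.coprod_apply, LinearMap.toSpanSingleton_apply,
        apply_add_smul_of_isotropic hy, apply_add_smul_of_isotropic hz, hfy, hgz, hfg]) rfl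
  exact ⟨γ, fun w => by simpa using hγ (w, 0)⟩

theorem exists_isometryEquiv_apply_pair_eq [FiniteDimensional F V] (h2 : (2 : F) ≠ 0)
    (hQ : Q.polarBilin.Nondegenerate) {u v u' v' : V} (h : LinearIndependent F ![u, v])
    (h' : LinearIndependent F ![u', v']) (hu : Q u = Q u') (hv : Q v = Q v')
    (huv : polar Q u v = polar Q u' v') : ∃ γ : Q.IsometryEquiv Q, γ u = u' ∧ γ v = v' := by
  let plane (x y : V) : F × F →ₗ[F] V :=
    (LinearMap.toSpanSingleton F V x).coprod (LinearMap.toSpanSingleton F V y)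
  have hinj {x y : V} (hxy : LinearIndependent F ![x, y]) : Function.Injective (plane x y) := by
    rw [injective_iff_map_eq_zero]
    exact fun p hp => Prod.ext_iff.2
      (LinearIndependent.pair_iff.1 hxy p.1 p.2 (by simpa [plane] using hp))
  obtain ⟨γ, hγ⟩ := exists_isometryEquiv_comp_eq h2 hQ (hinj h) (hinj h') fun p => by
    simp [plane, map_smul_add_smul, hu, hv, huv]
  exact ⟨γ, by simpa [plane] using hγ (1, 0), by simpa [plane] using hγ (0, 1)⟩

theorem exists_isometryEquiv_apply_eq_of_ne_zero [FiniteDimensional F V] (h2 : (2 : F) ≠ 0)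
    (hQ : Q.polarBilin.Nondegenerate) {u v : V} (hu : u ≠ 0) (hv : v ≠ 0) (h : Q u = Q v) :
    ∃ γ : Q.IsometryEquiv Q, γ u = v := by
  obtain ⟨γ, hγ⟩ := exists_isometryEquiv_comp_eq h2 hQ (f := LinearMap.toSpanSingleton F V u)
    (g := LinearMap.toSpanSingleton F V v) (smul_left_injective F hu) (smul_left_injective F hv)
    fun a => by simp [QuadraticMap.map_smul, h]
  exact ⟨γ, by simpa using hγ 1⟩

end Witt

section Discriminant

open QuadraticMap

variable {F V : Type*} [Field F] [AddCommGroup V] [Module F V] {Q : QuadraticForm F V}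
  {u v f g w : V}

/-- The discriminant of the binary form `(a, b) ↦ Q (a • u + b • v)`. Up to nonzero squares it
depends only on the plane spanned by `u` and `v`, and it decides how the corresponding projective
line meets the quadric `Q = 0`. -/
def disc (Q : QuadraticForm F V) (u v : V) : F := polar Q u v ^ 2 - 4 * Q u * Q v

theorem polar_smul_add_smul (Q : QuadraticForm F V) (a b c d : F) (u v : V) :
    polar Q (a • u + b • v) (c • u + d • v) =
      2 * a * c * Q u + (a * d + b * c) * polar Q u v + 2 * b * d * Q v := by
  simp only [polar_add_left, polar_add_right, polar_smul_left, polar_smul_right, polar_self,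
    polar_comm Q v u, smul_eq_mul, nsmul_eq_mul, Nat.cast_ofNat]
  ring

theorem disc_smul_add_smul (Q : QuadraticForm F V) (a b c d : F) (u v : V) :
    disc Q (a • u + b • v) (c • u + d • v) = (a * d - b * c) ^ 2 * disc Q u v := by
  simp only [disc, polar_smul_add_smul, map_smul_add_smul]
  ring

theorem exists_disc_eq_sq_mul (Q : QuadraticForm F V) (hf : f ∈ Submodule.span F {u, v})
    (hg : g ∈ Submodule.span F {u, v}) (hfg : LinearIndependent F ![f, g]) :
    ∃ c ≠ 0, disc Q f g = c ^ 2 * disc Q u v := by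
  obtain ⟨a, b, rfl⟩ := Submodule.mem_span_pair.1 hf
  obtain ⟨c, d, rfl⟩ := Submodule.mem_span_pair.1 hg
  refine ⟨a * d - b * c, fun h => ?_, disc_smul_add_smul Q a b c d u v⟩
  rw [LinearIndependent.pair_iff] at hfg
  obtain ⟨rfl, -⟩ := hfg d (-b) (by linear_combination (norm := module) h • u)
  obtain ⟨rfl, -⟩ := hfg c (-a) (by linear_combination (norm := module) (-h) • v)
  exact one_ne_zero (hfg 0 1 (by simp)).2

theorem exists_eq_smul_of_not_linearIndependent (h : ¬LinearIndependent F ![u, v]) :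
    ∃ (w : V) (a b : F), u = a • w ∧ v = b • w := by
  by_cases hu : u = 0
  · exact ⟨v, 0, 1, by simp [hu], (one_smul F v).symm⟩
  · rw [LinearIndependent.pair_iff' hu] at h
    push Not at h
    obtain ⟨b, hb⟩ := h
    exact ⟨u, 1, b, (one_smul F u).symm, hb.symm⟩

theorem linearIndependent_of_disc_ne_zero (h : disc Q u v ≠ 0) : LinearIndependent F ![u, v] := by
  by_contra huv
  obtain ⟨w, a, b, rfl, rfl⟩ := exists_eq_smul_of_not_linearIndependent huv
  exact h (by simpa using disc_smul_add_smul Q a 0 b 0 w 0)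

theorem disc_eq_zero_of_not_linearIndependent (h : ¬LinearIndependent F ![u, v]) :
    disc Q u v = 0 := not_not.1 (mt linearIndependent_of_disc_ne_zero h)

theorem eq_zero_of_disc_eq_zero {d : F} (h2 : (2 : F) ≠ 0) (hd : ¬IsSquare d) (huv : Q u = d * Q v)
    (h : disc Q u v = 0) : Q u = 0 ∧ Q v = 0 ∧ polar Q u v = 0 := by
  rw [disc] at h
  have hv : Q v = 0 := by
    by_contra hv
    refine hd ⟨polar Q u v / (2 * Q v), ?_⟩
    field_simp
    linear_combination -h - 4 * Q v * huv
  have hu : Q u = 0 := by rw [huv, hv, mul_zero]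
  exact ⟨hu, hv, by simpa [hu, hv] using h⟩

theorem finrank_span_pair (h : LinearIndependent F ![u, v]) :
    Module.finrank F (Submodule.span F {u, v}) = 2 := by
  rw [← Matrix.range_cons_cons_empty u v ![], finrank_span_eq_card h, Fintype.card_fin]

theorem span_pair_eq_of_finrank_eq_two {l : Submodule F V} (hl : Module.finrank F l = 2)
    (hu : u ∈ l) (hv : v ∈ l) (h : LinearIndependent F ![u, v]) :
    Submodule.span F {u, v} = l := by
  have : FiniteDimensional F l := Module.finite_of_finrank_pos (by omega)
  exact Submodule.eq_of_le_of_finrank_eq (Submodule.span_le.2 (Set.pair_subset hu hv))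
    ((finrank_span_pair h).trans hl.symm)

theorem isSquare_disc_of_isotropic (hw : w ∈ Submodule.span F {u, v}) (hw0 : w ≠ 0)
    (h : Q w = 0) : IsSquare (disc Q u v) := by
  obtain ⟨a, b, rfl⟩ := Submodule.mem_span_pair.1 hw
  rw [map_smul_add_smul] at h
  by_cases ha : a = 0
  · obtain rfl := ha
    have hv : Q v = 0 := by simpa [show b ≠ 0 by rintro rfl; simp at hw0] using h
    exact ⟨polar Q u v, by rw [disc, hv]; ring⟩
  · refine ⟨(2 * b * Q v + a * polar Q u v) / a, ?_⟩
    rw [disc]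
    field_simp
    linear_combination (-4 * Q v) * h

theorem exists_isotropic_of_isSquare_disc (h2 : (2 : F) ≠ 0) (huv : LinearIndependent F ![u, v])
    (h : IsSquare (disc Q u v)) : ∃ w ∈ Submodule.span F {u, v}, w ≠ 0 ∧ Q w = 0 := by
  by_cases hv : Q v = 0
  · exact ⟨v, Submodule.subset_span (by simp), huv.ne_zero 1, hv⟩
  · obtain ⟨s, hs⟩ := h
    refine ⟨(2 * Q v) • u + (s - polar Q u v) • v, Submodule.mem_span_pair.2 ⟨_, _, rfl⟩,
      fun h0 => mul_ne_zero h2 hv (LinearIndependent.pair_iff.1 huv _ _ h0).1, ?_⟩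
    rw [disc] at hs
    rw [map_smul_add_smul]
    linear_combination -Q v * hs

theorem exists_isotropic_pair (h2 : (2 : F) ≠ 0) (h : IsSquare (disc Q u v))
    (h0 : disc Q u v ≠ 0) : ∃ f ∈ Submodule.span F {u, v}, ∃ g ∈ Submodule.span F {u, v},
      Q f = 0 ∧ Q g = 0 ∧ polar Q f g ≠ 0 := by
  have hmem (a b : F) : a • u + b • v ∈ Submodule.span F {u, v} :=
    Submodule.mem_span_pair.2 ⟨a, b, rfl⟩
  by_cases hv : Q v = 0
  · refine ⟨_, hmem 0 1, _, hmem (polar Q u v) (-Q u), ?_, ?_, ?_⟩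
    · simpa using hv
    · rw [map_smul_add_smul, hv]
      ring
    · rw [polar_smul_add_smul, hv]
      rw [disc, hv] at h0
      convert h0 using 1
      ring
  · obtain ⟨s, hs⟩ := h
    have hs0 : s ≠ 0 := by
      rintro rfl
      exact h0 (by rw [hs, mul_zero])
    rw [disc] at hs
    refine ⟨_, hmem (2 * Q v) (s - polar Q u v), _, hmem (2 * Q v) (-s - polar Q u v), ?_, ?_, ?_⟩
    · rw [map_smul_add_smul]
      linear_combination -Q v * hs
    · rw [map_smul_add_smul]
      linear_combination -Q v * hs
    · rw [polar_smul_add_smul]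
      have : (2 : F) ^ 2 * Q v * s ^ 2 ≠ 0 := by simp [h2, hv, hs0]
      contrapose! this
      linear_combination -this - 2 * Q v * hs

end Discriminant

section Lines

open QuadraticMap

variable {F : Type*} [Field F] {n : ℕ} {Q : QuadraticForm F (Fin n → F)} {u v w : Fin n → F}
  {l : Submodule F (Fin n → F)}

theorem mk_mem_quadric_iff (hw : w ≠ 0) : Projectivization.mk F w hw ∈ quadric Q ↔ Q w = 0 := by
  simp only [quadric, Set.mem_ofPred_eq, Projectivization.submodule_mk]
  refine ⟨fun h => h w (Submodule.mem_span_singleton_self w), fun h x hx => ?_⟩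
  obtain ⟨a, rfl⟩ := Submodule.mem_span_singleton.1 hx
  rw [QuadraticMap.map_smul, h, smul_zero]

theorem mk_mem_points_iff (hw : w ≠ 0) : Projectivization.mk F w hw ∈ points l ↔ w ∈ l := Iff.rfl

theorem points_subset_quadric_iff : points l ⊆ quadric Q ↔ ∀ w ∈ l, Q w = 0 := by
  refine ⟨fun h w hw => ?_, fun h P => ?_⟩
  · by_cases hw0 : w = 0
    · rw [hw0, QuadraticMap.map_zero]
    · exact (mk_mem_quadric_iff hw0).1 (h hw)
  · induction P with
    | h w hw => exact fun hP => (mk_mem_quadric_iff hw).2 (h w hP)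

theorem points_inter_quadric_eq_empty_iff :
    points l ∩ quadric Q = ∅ ↔ ∀ w ∈ l, Q w = 0 → w = 0 := by
  rw [Set.eq_empty_iff_forall_notMem]
  refine ⟨fun h w hw hQw => by_contra fun hw0 =>
    h (.mk F w hw0) ⟨hw, (mk_mem_quadric_iff hw0).2 hQw⟩, fun h P => ?_⟩
  induction P with
  | h w hw => exact fun hP => hw (h w hP.1 ((mk_mem_quadric_iff hw).1 hP.2))

theorem points_span_pair_subset_quadric_iff :
    points (Submodule.span F {u, v}) ⊆ quadric Q ↔ Q u = 0 ∧ Q v = 0 ∧ polar Q u v = 0 := by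
  rw [points_subset_quadric_iff]
  constructor
  · intro h
    have hmem (a b : F) := h (a • u + b • v) (Submodule.mem_span_pair.2 ⟨a, b, rfl⟩)
    have hu : Q u = 0 := by simpa using hmem 1 0
    have hv : Q v = 0 := by simpa using hmem 0 1
    exact ⟨hu, hv, by simpa [polar, hu, hv] using hmem 1 1⟩
  · rintro ⟨hu, hv, huv⟩ w hw
    obtain ⟨a, b, rfl⟩ := Submodule.mem_span_pair.1 hw
    simp [map_smul_add_smul, hu, hv, huv]

theorem points_span_pair_inter_quadric_eq_empty_iff (h2 : (2 : F) ≠ 0)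
    (huv : LinearIndependent F ![u, v]) :
    points (Submodule.span F {u, v}) ∩ quadric Q = ∅ ↔ ¬IsSquare (disc Q u v) := by
  rw [points_inter_quadric_eq_empty_iff]
  refine ⟨fun h hsq => ?_, fun h w hw hQw => by_contra fun hw0 =>
    h (isSquare_disc_of_isotropic hw hw0 hQw)⟩
  obtain ⟨w, hw, hw0, hQw⟩ := exists_isotropic_of_isSquare_disc h2 huv hsq
  exact hw0 (h w hw hQw)

theorem points_inter_quadric_ncard_eq_two_of_isotropic_pair (hl : IsLine l) (hu : u ∈ l)
    (hv : v ∈ l) (hQu : Q u = 0) (hQv : Q v = 0) (huv : polar Q u v ≠ 0) :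
    (points l ∩ quadric Q).ncard = 2 := by
  have hli : LinearIndependent F ![u, v] := linearIndependent_of_disc_ne_zero (Q := Q) <| by
    simp [disc, hQu, huv]
  have hu0 : u ≠ 0 := hli.ne_zero 0
  have hv0 : v ≠ 0 := hli.ne_zero 1
  refine Set.ncard_eq_two.2 ⟨.mk F u hu0, .mk F v hv0, fun h => ?_, Set.ext fun P => ?_⟩
  · obtain ⟨a, rfl⟩ := (Projectivization.mk_eq_mk_iff' F u v hu0 hv0).1 h
    exact huv (by simp [polar_smul_left, polar_self, hQv])
  induction P with | h w hw => ?_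
  simp only [Set.mem_inter_iff, mk_mem_points_iff, mk_mem_quadric_iff, Set.mem_insert_iff,
    Set.mem_singleton_iff, Projectivization.mk_eq_mk_iff']
  constructor
  · rintro ⟨hwl, hQw⟩
    rw [← span_pair_eq_of_finrank_eq_two hl hu hv hli] at hwl
    obtain ⟨a, b, rfl⟩ := Submodule.mem_span_pair.1 hwl
    obtain rfl | rfl : a = 0 ∨ b = 0 := by simpa [map_smul_add_smul, hQu, hQv, huv] using hQw
    · exact .inr ⟨b, by simp⟩
    · exact .inl ⟨a, by simp⟩
  · rintro (⟨a, rfl⟩ | ⟨a, rfl⟩)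
    · exact ⟨l.smul_mem a hu, by simp [QuadraticMap.map_smul, hQu]⟩
    · exact ⟨l.smul_mem a hv, by simp [QuadraticMap.map_smul, hQv]⟩

theorem exists_isotropic_pair_of_points_inter_quadric_ncard_eq_two
    (h : (points l ∩ quadric Q).ncard = 2) :
    ∃ f ∈ l, ∃ g ∈ l, Q f = 0 ∧ Q g = 0 ∧ polar Q f g ≠ 0 := by
  obtain ⟨P, P', hPP', heq⟩ := Set.ncard_eq_two.1 h
  induction P with | h f hf => ?_
  induction P' with | h g hg => ?_
  obtain ⟨hfl, hQf⟩ : Projectivization.mk F f hf ∈ points l ∩ quadric Q := by simp [heq]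
  obtain ⟨hgl, hQg⟩ : Projectivization.mk F g hg ∈ points l ∩ quadric Q := by simp [heq]
  rw [mk_mem_quadric_iff] at hQf hQg
  refine ⟨f, hfl, g, hgl, hQf, hQg, fun hfg => ?_⟩
  have hsum : f + g ≠ 0 := fun h0 => hPP' <| (Projectivization.mk_eq_mk_iff' F f g hf hg).2
    ⟨-1, by rw [neg_one_smul, eq_neg_of_add_eq_zero_left h0]⟩
  -- If `f ⊥ g` then `f + g` would be a third point of the line on the quadric.
  have hmem : Projectivization.mk F (f + g) hsum ∈ points l ∩ quadric Q :=
    ⟨l.add_mem hfl hgl, (mk_mem_quadric_iff hsum).2 (by simpa [polar, hQf, hQg] using hfg)⟩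
  rw [heq] at hmem
  simp only [Set.mem_insert_iff, Set.mem_singleton_iff, Projectivization.mk_eq_mk_iff'] at hmem
  obtain ⟨a, ha⟩ | ⟨a, ha⟩ := hmem
  · exact hPP'.symm ((Projectivization.mk_eq_mk_iff' F g f hg hf).2
      ⟨a - 1, by rw [sub_smul, ha, one_smul, add_sub_cancel_left]⟩)
  · exact hPP' ((Projectivization.mk_eq_mk_iff' F f g hf hg).2
      ⟨a - 1, by rw [sub_smul, ha, one_smul, add_sub_cancel_right]⟩)

theorem points_span_pair_inter_quadric_ncard_eq_two_iff (h2 : (2 : F) ≠ 0)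
    (huv : LinearIndependent F ![u, v]) :
    (points (Submodule.span F {u, v}) ∩ quadric Q).ncard = 2 ↔
      IsSquare (disc Q u v) ∧ disc Q u v ≠ 0 := by
  constructor
  · intro h
    obtain ⟨f, hf, g, hg, hQf, -, hfg⟩ :=
      exists_isotropic_pair_of_points_inter_quadric_ncard_eq_two h
    have hdisc : disc Q f g ≠ 0 := by simp [disc, hQf, hfg]
    obtain ⟨c, -, hc⟩ := exists_disc_eq_sq_mul Q hf hg (linearIndependent_of_disc_ne_zero hdisc)
    refine ⟨isSquare_disc_of_isotropic hf ?_ hQf, right_ne_zero_of_mul (hc ▸ hdisc)⟩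
    rintro rfl
    simp at hfg
  · rintro ⟨hsq, h0⟩
    obtain ⟨f, hf, g, hg, hQf, hQg, hfg⟩ := exists_isotropic_pair h2 hsq h0
    exact points_inter_quadric_ncard_eq_two_of_isotropic_pair (finrank_span_pair huv)
      hf hg hQf hQg hfg

end Lines

section QuadraticExtension

open QuadraticMap

variable {F K : Type*} [Field F] [Field K] [Algebra F K] {d : F} {e : K}

theorem isSquare_sq_mul_iff {a b : F} (ha : a ≠ 0) : IsSquare (a ^ 2 * b) ↔ IsSquare b := by
  refine ⟨fun ⟨s, hs⟩ => ⟨s / a, ?_⟩, (IsSquare.sq a).mul⟩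
  field_simp
  linear_combination hs

theorem isSquare_mul_of_isSquare_iff [Finite F] {a b : F} (h : IsSquare a ↔ IsSquare b) :
    IsSquare (a * b) := by
  classical
  have := Fintype.ofFinite F
  by_cases ha : IsSquare a
  · exact ha.mul (h.1 ha)
  have hb : ¬IsSquare b := mt h.2 ha
  rw [← quadraticChar_one_iff_isSquare
    (mul_ne_zero (ne_zero_of_not_isSquare ha) (ne_zero_of_not_isSquare hb)), map_mul,
    quadraticChar_neg_one_iff_not_isSquare.2 ha, quadraticChar_neg_one_iff_not_isSquare.2 hb,
    neg_one_mul, neg_neg]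

/-- `K = F ⊕ e F` is a quadratic extension of `F`, generated by a square root `e` of the nonsquare
`d` of `F`. This provides the coordinates in which the Hermitian variety is studied. -/
structure IsQuadGen (d : F) (e : K) : Prop where
  not_isSquare : ¬IsSquare d
  sq_eq : e ^ 2 = algebraMap F K d
  exists_eq : ∀ z : K, ∃ a b : F, z = algebraMap F K a + e * algebraMap F K b

theorem exists_forall_eq_algebraMap_add_mul [Algebra.IsQuadraticExtension F K] :
    ∃ z : K, (∀ a : F, algebraMap F K a ≠ z) ∧
      ∀ w : K, ∃ a b : F, w = algebraMap F K a + algebraMap F K b * z := by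
  have hrank := Algebra.IsQuadraticExtension.finrank_eq_two F K
  obtain ⟨z, hz⟩ : ∃ z : K, ∀ a, algebraMap F K a ≠ z := by
    by_contra! h
    have hbot : (⊥ : Subalgebra F K) = ⊤ := eq_top_iff.2 fun z _ => Algebra.mem_bot.2 (h z)
    rw [Subalgebra.bot_eq_top_iff_finrank_eq_one] at hbot
    omega
  have hli : LinearIndependent F ![1, z] := (LinearIndependent.pair_iff' one_ne_zero).2
    fun a ha => hz a (by rw [← ha, Algebra.smul_def, mul_one])
  have hspan : Submodule.span F {1, z} = ⊤ :=
    span_pair_eq_of_finrank_eq_two ((finrank_top F K).trans hrank) trivial trivial hli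
  refine ⟨z, hz, fun w => ?_⟩
  obtain ⟨a, b, rfl⟩ := Submodule.mem_span_pair.1 (hspan ▸ Submodule.mem_top : w ∈ _)
  exact ⟨a, b, by rw [Algebra.smul_def, Algebra.smul_def, mul_one]⟩

theorem exists_isQuadGen [Algebra.IsQuadraticExtension F K] (h2 : (2 : F) ≠ 0) :
    ∃ (d : F) (e : K), IsQuadGen d e := by
  obtain ⟨z, hz, hspan⟩ := exists_forall_eq_algebraMap_add_mul (F := F) (K := K)
  obtain ⟨a, b, hab⟩ := hspan (z * z)
  have h2' : (2 : K) ≠ 0 := by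
    rw [← map_ofNat (algebraMap F K)]
    exact (map_ne_zero_iff _ (algebraMap F K).injective).2 h2
  -- Completing the square in `z ^ 2 = a + b z`.
  refine ⟨b ^ 2 + 4 * a, 2 * z - algebraMap F K b, ?_, ?_, fun w => ?_⟩
  · rintro ⟨s, hs⟩
    have hs' := congrArg (algebraMap F K) hs
    simp only [map_add, map_mul, map_pow, map_ofNat] at hs'
    have hfactor : (2 * z - algebraMap F K b - algebraMap F K s) *
        (2 * z - algebraMap F K b + algebraMap F K s) = 0 := by
      linear_combination 4 * hab + hs'
    obtain h | h := mul_eq_zero.1 hfactor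
    · refine hz ((b + s) / 2) ?_
      rw [map_div₀, map_add, map_ofNat, div_eq_iff h2']
      linear_combination -h
    · refine hz ((b - s) / 2) ?_
      rw [map_div₀, map_sub, map_ofNat, div_eq_iff h2']
      linear_combination -h
  · simp only [map_add, map_mul, map_pow, map_ofNat]
    linear_combination 4 * hab
  · obtain ⟨p, r, rfl⟩ := hspan w
    refine ⟨p + r * b / 2, r / 2, ?_⟩
    simp only [map_add, map_mul, map_div₀, map_ofNat]
    field_simp
    ring

theorem isQuadraticExtension_of_natCard_eq [Finite F] (hK : Nat.card K = Nat.card F ^ 2) :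
    Algebra.IsQuadraticExtension F K where
  finrank_eq_two' := by
    have : Finite K := Nat.finite_of_card_ne_zero (hK ▸ pow_ne_zero 2 Nat.card_pos.ne')
    rw [Module.natCard_eq_pow_finrank (K := F)] at hK
    exact Nat.pow_right_injective Finite.one_lt_card hK

theorem two_ne_zero_of_odd_natCard [Finite F] (hF : Odd (Nat.card F)) : (2 : F) ≠ 0 := by
  have := Fintype.ofFinite F
  rw [Nat.card_eq_fintype_card, Nat.odd_iff] at hF
  exact Ring.two_ne_zero fun h => by simp [FiniteField.even_card_iff_char_two.1 h] at hF

theorem exists_isQuadGen_of_natCard_eq [Finite F] (hF : Odd (Nat.card F))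
    (hK : Nat.card K = Nat.card F ^ 2) : ∃ (d : F) (e : K), IsQuadGen d e :=
  have := isQuadraticExtension_of_natCard_eq hK
  exists_isQuadGen (two_ne_zero_of_odd_natCard hF)

namespace IsQuadGen

theorem ne_zero (h : IsQuadGen d e) : d ≠ 0 := ne_zero_of_not_isSquare h.not_isSquare

theorem algebraMap_add_mul_eq_zero (h : IsQuadGen d e) {a b : F}
    (hab : algebraMap F K a + e * algebraMap F K b = 0) : a = 0 ∧ b = 0 := by
  have hb : b = 0 := by
    by_contra hb
    refine h.not_isSquare ⟨a / b, (algebraMap F K).injective ?_⟩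
    have hb' : algebraMap F K b ≠ 0 := by simpa using hb
    rw [← h.sq_eq, map_mul, map_div₀]
    field_simp
    linear_combination (-algebraMap F K a + e * algebraMap F K b) * hab
  exact ⟨by simpa [hb] using hab, hb⟩

theorem bijective (h : IsQuadGen d e) :
    Function.Bijective fun p : F × F => algebraMap F K p.1 + e * algebraMap F K p.2 := by
  refine ⟨fun p p' hp => ?_, fun z => ?_⟩
  · obtain ⟨h1, h2⟩ := h.algebraMap_add_mul_eq_zero (a := p.1 - p'.1) (b := p.2 - p'.2) (by
      rw [map_sub, map_sub]
      linear_combination hp)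
    exact Prod.ext (sub_eq_zero.1 h1) (sub_eq_zero.1 h2)
  · obtain ⟨a, b, hz⟩ := h.exists_eq z
    exact ⟨(a, b), hz.symm⟩

theorem natCard_eq (h : IsQuadGen d e) : Nat.card K = Nat.card F ^ 2 := by
  rw [← Nat.card_eq_of_bijective _ h.bijective, Nat.card_prod, pow_two]

variable [Finite F]

theorem ringChar_ne_two (h : IsQuadGen d e) : ringChar F ≠ 2 := fun h2 =>
  h.not_isSquare (FiniteField.isSquare_of_char_two h2 d)

theorem two_ne_zero (h : IsQuadGen d e) : (2 : F) ≠ 0 := Ring.two_ne_zero h.ringChar_ne_two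

theorem two_mul_ne_zero (h : IsQuadGen d e) : 2 * e ≠ 0 := fun h0 =>
  h.two_ne_zero (h.algebraMap_add_mul_eq_zero (a := 0) (b := 2) (by
    rw [map_zero, map_ofNat, zero_add, mul_comm, h0])).2

theorem finite (h : IsQuadGen d e) : Finite K := .of_surjective _ h.bijective.2

theorem pow_natCard (h : IsQuadGen d e) : e ^ Nat.card F = -e := by
  have := Fintype.ofFinite F
  have hpow : d ^ (Fintype.card F / 2) = -1 :=
    (FiniteField.pow_dichotomy h.ringChar_ne_two h.ne_zero).resolve_left
      (mt (FiniteField.isSquare_iff h.ringChar_ne_two h.ne_zero).2 h.not_isSquare)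
  have hodd := FiniteField.odd_card_of_char_ne_two h.ringChar_ne_two
  rw [Nat.card_eq_fintype_card, ← Nat.div_add_mod (Fintype.card F) 2, hodd, pow_succ, pow_mul,
    h.sq_eq, ← map_pow, hpow, map_neg, map_one, neg_one_mul]

theorem add_mul_pow_natCard (h : IsQuadGen d e) (a b : F) :
    (algebraMap F K a + e * algebraMap F K b) ^ Nat.card F =
      algebraMap F K a - e * algebraMap F K b := by
  have := Fintype.ofFinite F
  have hfrob := map_add (FiniteField.frobeniusAlgHom F K) (algebraMap F K a)
    (e * algebraMap F K b)
  have he := h.pow_natCard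
  rw [Nat.card_eq_fintype_card] at he ⊢
  simp only [FiniteField.coe_frobeniusAlgHom, mul_pow, he, ← map_pow,
    FiniteField.pow_card] at hfrob
  rw [hfrob]
  ring

theorem isSquare_iff (h : IsQuadGen d e) (a b : F) :
    IsSquare (algebraMap F K a + e * algebraMap F K b) ↔ IsSquare (a ^ 2 - d * b ^ 2) := by
  by_cases h0 : algebraMap F K a + e * algebraMap F K b = 0
  · obtain ⟨rfl, rfl⟩ := h.algebraMap_add_mul_eq_zero h0
    simp
  have := h.finite
  have := Fintype.ofFinite F
  have := Fintype.ofFinite K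
  have hK : ringChar K ≠ 2 := fun hK => h.two_ne_zero ((algebraMap F K).injective (by
    rw [map_ofNat, map_zero, ← Nat.cast_two, ← hK, ringChar.Nat.cast_ringChar]))
  -- The norm of an element of `K` is its `(q + 1)`-st power.
  have hnorm : algebraMap F K (a ^ 2 - d * b ^ 2) =
      (algebraMap F K a + e * algebraMap F K b) ^ (Nat.card F + 1) := by
    rw [pow_succ _ (Nat.card F), h.add_mul_pow_natCard]
    simp only [map_sub, map_mul, map_pow, ← h.sq_eq]
    ring
  have hnorm0 : a ^ 2 - d * b ^ 2 ≠ 0 := fun h1 =>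
    pow_ne_zero _ h0 (by rw [← hnorm, h1, map_zero])
  have hcard : Fintype.card K / 2 = (Nat.card F + 1) * (Fintype.card F / 2) := by
    obtain ⟨m, hm⟩ := Nat.odd_iff.2 (FiniteField.odd_card_of_char_ne_two h.ringChar_ne_two)
    have hsq : Fintype.card K = 2 * ((2 * m + 1 + 1) * m) + 1 := by
      rw [← Nat.card_eq_fintype_card, h.natCard_eq, Nat.card_eq_fintype_card, hm]
      ring
    rw [Nat.card_eq_fintype_card, hsq, hm, show (2 * m + 1) / 2 = m by omega]
    omega
  rw [FiniteField.isSquare_iff h.ringChar_ne_two hnorm0, FiniteField.isSquare_iff hK h0, hcard,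
    pow_mul, ← hnorm, ← map_pow, map_eq_one_iff _ (algebraMap F K).injective]

end IsQuadGen

variable {n : ℕ}

/-- The vector `u + e v` of `K ^ n`. For `e` as in `IsQuadGen`, every vector of `K ^ n` has this
form for exactly one pair of vectors `u`, `v` of `F ^ n`. -/
def comb (e : K) (u v : Fin n → F) : Fin n → K := incl K u + e • incl K v

theorem comb_apply (e : K) (u v : Fin n → F) (i : Fin n) :
    comb e u v i = algebraMap F K (u i) + e * algebraMap F K (v i) := rfl

theorem comb_zero (e : K) (u : Fin n → F) : comb e u 0 = incl K u := by
  simp [comb]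

theorem IsQuadGen.comb_bijective (h : IsQuadGen d e) (n : ℕ) :
    Function.Bijective fun p : (Fin n → F) × (Fin n → F) => comb e p.1 p.2 := by
  refine ⟨fun p p' hp => ?_, fun x => ?_⟩
  · have hi (i : Fin n) : (p.1 i, p.2 i) = (p'.1 i, p'.2 i) := h.bijective.1 (congrFun hp i)
    simp only [Prod.mk.injEq, forall_and, ← funext_iff] at hi
    exact Prod.ext hi.1 hi.2
  · choose a b hab using fun i => h.exists_eq (x i)
    exact ⟨(a, b), funext fun i => (hab i).symm⟩

theorem IsQuadGen.exists_comb_eq (h : IsQuadGen d e) (x : Fin n → K) :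
    ∃ u v : Fin n → F, comb e u v = x :=
  have ⟨p, hp⟩ := (h.comb_bijective n).2 x
  ⟨p.1, p.2, hp⟩

theorem IsQuadGen.smul_comb (h : IsQuadGen d e) (a b : F) (u v : Fin n → F) :
    (algebraMap F K a + e * algebraMap F K b) • comb e u v =
      comb e (a • u + (d * b) • v) (b • u + a • v) := by
  ext i
  simp only [comb_apply, Pi.add_apply, Pi.smul_apply, smul_eq_mul, map_add, map_mul, ← h.sq_eq]
  ring

theorem mulVec_comb (g : GL (Fin n) F) (e : K) (u v : Fin n → F) :
    (Matrix.GeneralLinearGroup.map (algebraMap F K) g).1.mulVec (comb e u v) =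
      comb e (g.1.mulVec u) (g.1.mulVec v) := by
  have hincl (w : Fin n → F) : (Matrix.GeneralLinearGroup.map (algebraMap F K) g).1.mulVec
      (incl K w) = incl K (g.1.mulVec w) :=
    funext fun i => (RingHom.map_mulVec (algebraMap F K) g.1 w i).symm
  rw [comb, Matrix.mulVec_add, Matrix.mulVec_smul, hincl, hincl, comb]

variable {Q : QuadraticForm F (Fin n → F)} {u v u' v' : Fin n → F}

theorem polarExt_incl (Q : QuadraticForm F (Fin n → F)) (u v : Fin n → F) :
    polarExt K Q (incl K u) (incl K v) = algebraMap F K (polar Q u v) := by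
  have h : polar Q u v = Matrix.toBilin' (LinearMap.BilinForm.toMatrix' Q.polarBilin) u v := by
    rw [Matrix.toBilin'_toMatrix', polarBilin_apply_apply]
  rw [h, polarExt, Matrix.toBilin'_apply, Matrix.toBilin'_apply]
  simp [incl]

theorem polarExt_comb (Q : QuadraticForm F (Fin n → F)) (e f : K) (u v u' v' : Fin n → F) :
    polarExt K Q (comb e u v) (comb f u' v') = algebraMap F K (polar Q u u') +
      f * algebraMap F K (polar Q u v') + e * algebraMap F K (polar Q v u') +
      e * f * algebraMap F K (polar Q v v') := by
  simp only [comb, map_add, map_smul, LinearMap.add_apply, LinearMap.smul_apply, polarExt_incl,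
    smul_eq_mul]
  ring

namespace IsQuadGen

theorem polarExt_comb_self (h : IsQuadGen d e) (Q : QuadraticForm F (Fin n → F))
    (u v : Fin n → F) : polarExt K Q (comb e u v) (comb e u v) =
      algebraMap F K (2 * (Q u + d * Q v)) + e * algebraMap F K (2 * polar Q u v) := by
  rw [polarExt_comb, polar_self, polar_self, polar_comm Q v u]
  simp only [nsmul_eq_mul, map_mul, map_add, map_ofNat, Nat.cast_ofNat, ← h.sq_eq]
  ring

variable [Finite F]

theorem tau_comb (h : IsQuadGen d e) (u v : Fin n → F) :
    tau F K (comb e u v) = comb (-e) u v := by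
  ext i
  rw [tau, comb_apply, comb_apply, h.add_mul_pow_natCard, neg_mul, sub_eq_add_neg]

theorem hermForm_comb_self_eq_zero_iff (h : IsQuadGen d e) :
    hermForm K Q (comb e u v) (comb e u v) = 0 ↔ Q u = d * Q v := by
  have hform : hermForm K Q (comb e u v) (comb e u v) = algebraMap F K (2 * (Q u - d * Q v)) := by
    rw [hermForm, h.tau_comb, polarExt_comb, polar_self, polar_self, polar_comm Q v u]
    simp only [nsmul_eq_mul, map_mul, map_sub, map_ofNat, Nat.cast_ofNat, ← h.sq_eq]
    ring
  rw [hform, map_eq_zero_iff _ (algebraMap F K).injective, mul_eq_zero, sub_eq_zero,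
    or_iff_right h.two_ne_zero]

/-- On the Hermitian variety the norm of `2 e B(x, x)` is `16 d ^ 2` times the discriminant. -/
theorem isSquare_two_mul_polarExt_comb_self_iff (h : IsQuadGen d e) (huv : Q u = d * Q v) :
    IsSquare (2 * e * polarExt K Q (comb e u v) (comb e u v)) ↔ IsSquare (disc Q u v) := by
  have heq : 2 * e * polarExt K Q (comb e u v) (comb e u v) =
      algebraMap F K (4 * d * polar Q u v) + e * algebraMap F K (8 * d * Q v) := by
    rw [h.polarExt_comb_self, huv]
    simp only [map_mul, map_add, map_ofNat, ← h.sq_eq]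
    ring
  have hnorm : (4 * d * polar Q u v) ^ 2 - d * (8 * d * Q v) ^ 2 = (4 * d) ^ 2 * disc Q u v := by
    rw [disc, huv]
    ring
  rw [heq, h.isSquare_iff, hnorm]
  exact isSquare_sq_mul_iff (mul_ne_zero (by
    rw [show (4 : F) = 2 ^ 2 by norm_num]
    exact pow_ne_zero 2 h.two_ne_zero) h.ne_zero)

theorem polarExt_comb_self_eq_iff (h : IsQuadGen d e) (huv : Q u = d * Q v)
    (huv' : Q u' = d * Q v') :
    polarExt K Q (comb e u v) (comb e u v) = polarExt K Q (comb e u' v') (comb e u' v') ↔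
      Q v = Q v' ∧ polar Q u v = polar Q u' v' := by
  have hd : 2 * (d + d) ≠ 0 := by
    rw [← two_mul]
    exact mul_ne_zero h.two_ne_zero (mul_ne_zero h.two_ne_zero h.ne_zero)
  rw [h.polarExt_comb_self, h.polarExt_comb_self, huv, huv', ← add_mul, ← add_mul, ← mul_assoc,
    ← mul_assoc, h.bijective.1.eq_iff' (a := (_, _)) (b := (_, _)) rfl]
  simp [hd, h.two_ne_zero]

end IsQuadGen

end QuadraticExtension

section PointClasses

open QuadraticMap

variable {F K : Type*} [Field F] [Field K] [Algebra F K] {n : ℕ}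
  {Q : QuadraticForm F (Fin n → F)} {d : F} {e : K} {u v w : Fin n → F}

theorem mk_mem_hermitian_iff_hermForm_eq_zero {x : Fin n → K} (hx : x ≠ 0) :
    Projectivization.mk K x hx ∈ hermitian K Q ↔ hermForm K Q x x = 0 := by
  simp only [hermitian, Set.mem_ofPred_eq, Projectivization.submodule_mk]
  refine ⟨fun h => h x (Submodule.mem_span_singleton_self x), fun h y hy => ?_⟩
  obtain ⟨a, rfl⟩ := Submodule.mem_span_singleton.1 hy
  have htau : tau F K (a • x) = a ^ Nat.card F • tau F K x := by
    ext i
    simp [tau, mul_pow]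
  rw [hermForm] at h
  rw [hermForm, htau, map_smul, map_smul, LinearMap.smul_apply, h, smul_zero, smul_zero]

namespace IsQuadGen

theorem comb_mem_extend_iff (h : IsQuadGen d e) {l : Submodule F (Fin n → F)} :
    comb e u v ∈ extend K l ↔ u ∈ l ∧ v ∈ l := by
  constructor
  · intro hx
    have hspan (x) (hx : x ∈ extend K l) : ∃ u ∈ l, ∃ v ∈ l, comb e u v = x := by
      induction hx using Submodule.span_induction with
      | mem x hx =>
        obtain ⟨w, hw, rfl⟩ := hx
        exact ⟨w, hw, 0, l.zero_mem, comb_zero e w⟩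
      | zero => exact ⟨0, l.zero_mem, 0, l.zero_mem, by simp [comb]⟩
      | add x y _ _ hx hy =>
        obtain ⟨u, hu, v, hv, rfl⟩ := hx
        obtain ⟨u', hu', v', hv', rfl⟩ := hy
        refine ⟨u + u', l.add_mem hu hu', v + v', l.add_mem hv hv', ?_⟩
        simp only [comb, map_add, smul_add]
        abel
      | smul z x _ hx =>
        obtain ⟨u, hu, v, hv, rfl⟩ := hx
        obtain ⟨a, b, rfl⟩ := h.exists_eq z
        rw [h.smul_comb]
        exact ⟨_, l.add_mem (l.smul_mem _ hu) (l.smul_mem _ hv), _,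
          l.add_mem (l.smul_mem _ hu) (l.smul_mem _ hv), rfl⟩
    obtain ⟨u', hu', v', hv', huv⟩ := hspan _ hx
    obtain ⟨rfl, rfl⟩ := Prod.ext_iff.1 ((h.comb_bijective n).1 (a₁ := (u', v')) (a₂ := (u, v)) huv)
    exact ⟨hu', hv'⟩
  · rintro ⟨hu, hv⟩
    exact Submodule.add_mem _ (Submodule.subset_span ⟨u, hu, rfl⟩)
      (Submodule.smul_mem _ _ (Submodule.subset_span ⟨v, hv, rfl⟩))

/-- A point of `PG(n - 1, K)` outside `PG(n - 1, F)` is on the extension of exactly one line. -/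
theorem exists_isLine_mem_points_extend_iff (h : IsQuadGen d e) (hx : comb e u v ≠ 0)
    (huv : LinearIndependent F ![u, v]) {p : Submodule F (Fin n → F) → Prop} :
    (∃ l, IsLine l ∧ p l ∧ Projectivization.mk K _ hx ∈ points (extend K l)) ↔
      p (Submodule.span F {u, v}) := by
  simp only [mk_mem_points_iff, h.comb_mem_extend_iff]
  refine ⟨fun ⟨l, hl, hp, hu, hv⟩ => ?_, fun hp => ⟨_, finrank_span_pair huv, hp,
    Submodule.subset_span (by simp), Submodule.subset_span (by simp)⟩⟩
  rwa [span_pair_eq_of_finrank_eq_two hl hu hv huv]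

theorem embed_mk_eq_mk_comb_iff (h : IsQuadGen d e) (hx : comb e u v ≠ 0) (hw : w ≠ 0) :
    embed K (Projectivization.mk F w hw) = Projectivization.mk K _ hx ↔
      ∃ a b : F, u = a • w ∧ v = b • w := by
  have hsmul (a b : F) :
      (algebraMap F K a + e * algebraMap F K b) • incl K w = comb e (a • w) (b • w) := by
    simpa [comb_zero] using h.smul_comb a b w 0
  rw [eq_comm, embed, Projectivization.map_mk, Projectivization.mk_eq_mk_iff']
  constructor
  · rintro ⟨z, hz⟩
    obtain ⟨a, b, rfl⟩ := h.exists_eq z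
    rw [hsmul] at hz
    have hab := (h.comb_bijective n).1 (a₁ := (a • w, b • w)) (a₂ := (u, v)) hz
    exact ⟨a, b, (congrArg Prod.fst hab).symm, (congrArg Prod.snd hab).symm⟩
  · rintro ⟨a, b, rfl, rfl⟩
    exact ⟨_, hsmul a b⟩

theorem mk_mem_range_embed_iff (h : IsQuadGen d e) (hx : comb e u v ≠ 0) :
    Projectivization.mk K _ hx ∈ Set.range (embed (F := F) (n := n) K) ↔
      ¬LinearIndependent F ![u, v] := by
  constructor
  · rintro ⟨P, hP⟩ hi
    induction P with | h w hw => ?_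
    obtain ⟨a, b, rfl, rfl⟩ := (h.embed_mk_eq_mk_comb_iff hx hw).1 hP
    obtain ⟨rfl, ha⟩ := LinearIndependent.pair_iff.1 hi b (-a) (by module)
    exact hx (by simp [comb, neg_eq_zero.1 ha])
  · intro hi
    obtain ⟨w, a, b, hu, hv⟩ := exists_eq_smul_of_not_linearIndependent hi
    have hw : w ≠ 0 := by
      rintro rfl
      exact hx (by simp [hu, hv, comb])
    exact ⟨_, (h.embed_mk_eq_mk_comb_iff hx hw).2 ⟨a, b, hu, hv⟩⟩

theorem mk_mem_setQ_iff (h : IsQuadGen d e) (hx : comb e u v ≠ 0) :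
    Projectivization.mk K _ hx ∈ setQ K Q ↔ Q u = d * Q v ∧ ¬LinearIndependent F ![u, v] := by
  rw [← h.mk_mem_range_embed_iff hx]
  constructor
  · rintro ⟨P, hP, hPx⟩
    refine ⟨?_, P, hPx⟩
    induction P with | h w hw => ?_
    obtain ⟨a, b, rfl, rfl⟩ := (h.embed_mk_eq_mk_comb_iff hx hw).1 hPx
    simp [QuadraticMap.map_smul, (mk_mem_quadric_iff hw).1 hP]
  · rintro ⟨hq, P, hPx⟩
    refine ⟨P, ?_, hPx⟩
    induction P with | h w hw => ?_
    obtain ⟨a, b, rfl, rfl⟩ := (h.embed_mk_eq_mk_comb_iff hx hw).1 hPx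
    rw [mk_mem_quadric_iff]
    by_contra hw0
    have hab : a ^ 2 = d * b ^ 2 := mul_right_cancel₀ hw0 (by
      simp only [QuadraticMap.map_smul, smul_eq_mul] at hq
      linear_combination hq)
    by_cases hb : b = 0
    · have ha : a = 0 := by simpa [hb] using hab
      exact hx (by simp [ha, hb, comb])
    · exact h.not_isSquare ⟨a / b, by
        field_simp
        exact hab.symm⟩

variable [Finite F]

theorem mk_mem_hermitian_iff (h : IsQuadGen d e) (hx : comb e u v ≠ 0) :
    Projectivization.mk K _ hx ∈ hermitian K Q ↔ Q u = d * Q v := by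
  rw [mk_mem_hermitian_iff_hermForm_eq_zero, h.hermForm_comb_self_eq_zero_iff]

theorem mk_mem_setO_iff (h : IsQuadGen d e) (hx : comb e u v ≠ 0) :
    Projectivization.mk K _ hx ∈ setO K Q ↔
      Q u = d * Q v ∧ LinearIndependent F ![u, v] ∧ disc Q u v = 0 := by
  rw [setO, Set.mem_ofPred_eq, h.mk_mem_range_embed_iff, not_not, and_left_comm]
  refine and_congr_right fun huv => ?_
  rw [h.exists_isLine_mem_points_extend_iff hx huv (p := fun l => points l ⊆ quadric Q),
    points_span_pair_subset_quadric_iff]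
  constructor
  · rintro ⟨hu, hv, hb⟩
    simp [disc, hu, hv, hb]
  · rintro ⟨hq, hd⟩
    exact eq_zero_of_disc_eq_zero h.two_ne_zero h.not_isSquare hq hd

theorem mk_mem_setE_iff (h : IsQuadGen d e) (hx : comb e u v ≠ 0) :
    Projectivization.mk K _ hx ∈ setE K Q ↔ Q u = d * Q v ∧ ¬IsSquare (disc Q u v) := by
  rw [setE, Set.mem_ofPred_eq, h.mk_mem_hermitian_iff]
  refine and_congr_right fun hq => ?_
  by_cases huv : LinearIndependent F ![u, v]
  · rw [h.exists_isLine_mem_points_extend_iff hx huv (p := fun l => points l ∩ quadric Q = ∅),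
      points_span_pair_inter_quadric_eq_empty_iff h.two_ne_zero huv]
  · have hd : disc Q u v = 0 := disc_eq_zero_of_not_linearIndependent huv
    refine iff_of_false ?_ (by simp [hd])
    rintro ⟨l, -, hl, hxl⟩
    rw [points_inter_quadric_eq_empty_iff] at hl
    obtain ⟨hul, hvl⟩ := h.comb_mem_extend_iff.1 hxl
    obtain ⟨hu, hv, -⟩ := eq_zero_of_disc_eq_zero h.two_ne_zero h.not_isSquare hq hd
    exact hx (by simp [comb, hl u hul hu, hl v hvl hv])

theorem mk_mem_setS_iff (h : IsQuadGen d e) (hx : comb e u v ≠ 0) :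
    Projectivization.mk K _ hx ∈ setS K Q ↔
      Q u = d * Q v ∧ IsSquare (disc Q u v) ∧ disc Q u v ≠ 0 := by
  rw [setS, Set.mem_ofPred_eq, Set.mem_sdiff, h.mk_mem_hermitian_iff, h.mk_mem_setQ_iff, and_assoc]
  refine and_congr_right fun hq => ?_
  by_cases huv : LinearIndependent F ![u, v]
  · rw [h.exists_isLine_mem_points_extend_iff hx huv
        (p := fun l => (points l ∩ quadric Q).ncard = 2),
      points_span_pair_inter_quadric_ncard_eq_two_iff h.two_ne_zero huv]
    simp [huv]
  · simp [huv, hq, disc_eq_zero_of_not_linearIndependent huv]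

end IsQuadGen

end PointClasses

section Orbits

open QuadraticMap

variable {F K : Type*} [Field F] [Field K] [Algebra F K] {n : ℕ}
  {Q : QuadraticForm F (Fin n → F)} {d : F} {e : K} {u v u' v' : Fin n → F}

theorem mem_groupG_iff {γ : PGL(n, K)} : γ ∈ groupG K Q ↔ ∃ g ∈ similitudeGroup Q,
    Matrix.ProjGenLinGroup.mk (Matrix.GeneralLinearGroup.map (algebraMap F K) g) = γ := by
  constructor
  · rintro ⟨_, ⟨g, hg, rfl⟩, rfl⟩
    exact ⟨g, hg, rfl⟩
  · rintro ⟨g, hg, rfl⟩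
    exact ⟨_, ⟨g, hg, rfl⟩, rfl⟩

theorem comb_mulVec_ne_zero (g : GL (Fin n) F) (hx : comb e u v ≠ 0) :
    comb e (g.1.mulVec u) (g.1.mulVec v) ≠ 0 := by
  rw [← mulVec_comb]
  exact (smul_ne_zero_iff_ne (Matrix.GeneralLinearGroup.map (algebraMap F K) g)).2 hx

theorem mk_map_smul_mk_comb (g : GL (Fin n) F) (hx : comb e u v ≠ 0) :
    (Matrix.ProjGenLinGroup.mk (Matrix.GeneralLinearGroup.map (algebraMap F K) g) : PGL(n, K)) •
      Projectivization.mk K _ hx = Projectivization.mk K _ (comb_mulVec_ne_zero g hx) := by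
  rw [Projectivization.PGL.mk_smul_mk]
  congr 1
  exact mulVec_comb g e u v

theorem linearIndependent_mulVec_pair_iff (g : GL (Fin n) F) :
    LinearIndependent F ![g.1.mulVec u, g.1.mulVec v] ↔ LinearIndependent F ![u, v] := by
  have hker : LinearMap.ker g.1.mulVecLin = ⊥ :=
    LinearMap.ker_eq_bot.2 (Matrix.mulVec_injective_of_isUnit g.isUnit)
  have hcomp : g.1.mulVecLin ∘ ![u, v] = ![g.1.mulVec u, g.1.mulVec v] := by
    ext i : 1
    fin_cases i <;> rfl
  rw [← hcomp, LinearMap.linearIndependent_iff g.1.mulVecLin hker]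

section Similitude

variable {g : GL (Fin n) F} {c : Fˣ}

theorem apply_mulVec_eq_mul_iff (hg : ∀ w, Q (g.1.mulVec w) = c * Q w) :
    Q (g.1.mulVec u) = d * Q (g.1.mulVec v) ↔ Q u = d * Q v := by
  rw [hg, hg, mul_left_comm, mul_right_inj' c.ne_zero]

theorem disc_mulVec (hg : ∀ w, Q (g.1.mulVec w) = c * Q w) (u v : Fin n → F) :
    disc Q (g.1.mulVec u) (g.1.mulVec v) = (c : F) ^ 2 * disc Q u v := by
  simp only [disc, polar, ← Matrix.mulVec_add, hg]
  ring

theorem disc_mulVec_eq_zero_iff (hg : ∀ w, Q (g.1.mulVec w) = c * Q w) :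
    disc Q (g.1.mulVec u) (g.1.mulVec v) = 0 ↔ disc Q u v = 0 := by
  rw [disc_mulVec hg, mul_eq_zero, or_iff_right (pow_ne_zero _ c.ne_zero)]

theorem isSquare_disc_mulVec_iff (hg : ∀ w, Q (g.1.mulVec w) = c * Q w) :
    IsSquare (disc Q (g.1.mulVec u) (g.1.mulVec v)) ↔ IsSquare (disc Q u v) := by
  rw [disc_mulVec hg, isSquare_sq_mul_iff c.ne_zero]

end Similitude

theorem mk_comb_mem_orbit_of_isometryEquiv (hx : comb e u v ≠ 0) (hx' : comb e u' v' ≠ 0)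
    (γ : Q.IsometryEquiv Q) (hu : γ u = u') (hv : γ v = v') :
    Projectivization.mk K _ hx' ∈ MulAction.orbit (groupG K Q) (Projectivization.mk K _ hx) := by
  subst hu hv
  let g : GL (Fin n) F := Matrix.GeneralLinearGroup.toLin.symm
    (LinearMap.GeneralLinearGroup.ofLinearEquiv γ.toLinearEquiv)
  have hg (w) : g.1.mulVec w = γ w := by
    rw [← Matrix.mulVecLin_apply, ← Matrix.GeneralLinearGroup.coe_toLin, MulEquiv.apply_symm_apply]
    rfl
  have hgQ : g ∈ similitudeGroup Q := ⟨1, fun w => by rw [hg, γ.map_app, Units.val_one, one_mul]⟩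
  refine ⟨⟨_, mem_groupG_iff.2 ⟨g, hgQ, rfl⟩⟩, (mk_map_smul_mk_comb g hx).trans ?_⟩
  simp only [hg]

namespace IsQuadGen

theorem induction_comb (h : IsQuadGen d e) {p : ℙ K (Fin n → K) → Prop}
    (hp : ∀ (u v : Fin n → F) (hx : comb e u v ≠ 0), p (Projectivization.mk K _ hx)) (P) : p P := by
  induction P with | h x hx => ?_
  obtain ⟨u, v, rfl⟩ := h.exists_comb_eq x
  exact hp u v hx

theorem smul_mem_iff (h : IsQuadGen d e) {X : Set (ℙ K (Fin n → K))}
    {p : (Fin n → F) → (Fin n → F) → Prop}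
    (hX : ∀ (u v : Fin n → F) (hx : comb e u v ≠ 0), Projectivization.mk K _ hx ∈ X ↔ p u v)
    (hp : ∀ (g : GL (Fin n) F) (c : Fˣ), (∀ w, Q (g.1.mulVec w) = c * Q w) →
      ∀ u v, p (g.1.mulVec u) (g.1.mulVec v) ↔ p u v)
    (γ : groupG K Q) (P : ℙ K (Fin n → K)) : γ • P ∈ X ↔ P ∈ X := by
  obtain ⟨γ, hγ⟩ := γ
  obtain ⟨g, ⟨c, hg⟩, rfl⟩ := mem_groupG_iff.1 hγ
  induction P using h.induction_comb with | hp u v hx => ?_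
  rw [Subgroup.mk_smul, mk_map_smul_mk_comb, hX, hX, hp g c hg]

theorem smul_mem_setQ_iff (h : IsQuadGen d e) (γ : groupG K Q) (P : ℙ K (Fin n → K)) :
    γ • P ∈ setQ K Q ↔ P ∈ setQ K Q :=
  h.smul_mem_iff (fun _ _ => h.mk_mem_setQ_iff) (fun g _ hg _ _ => by
    rw [apply_mulVec_eq_mul_iff hg, linearIndependent_mulVec_pair_iff g]) γ P

theorem mem_orbit_of_mem_setQ (h : IsQuadGen d e) (h2 : (2 : F) ≠ 0)
    (hQ : Q.polarBilin.Nondegenerate) {P P' : ℙ K (Fin n → K)} (hP : P ∈ setQ K Q)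
    (hP' : P' ∈ setQ K Q) : P' ∈ MulAction.orbit (groupG K Q) P := by
  obtain ⟨P, hP, rfl⟩ := hP
  obtain ⟨P', hP', rfl⟩ := hP'
  induction P with | h w hw => ?_
  induction P' with | h w' hw' => ?_
  rw [mk_mem_quadric_iff] at hP hP'
  obtain ⟨γ, hγ⟩ := exists_isometryEquiv_apply_eq_of_ne_zero h2 hQ hw hw' (hP.trans hP'.symm)
  have hne {w : Fin n → F} (hw : w ≠ 0) : comb e w 0 ≠ 0 := by
    rw [comb_zero]
    exact (map_ne_zero_iff _ (incl_injective K)).2 hw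
  have hmk {w : Fin n → F} (hw : w ≠ 0) :
      embed K (Projectivization.mk F w hw) = Projectivization.mk K _ (hne hw) :=
    (h.embed_mk_eq_mk_comb_iff (hne hw) hw).2 ⟨1, 0, (one_smul F w).symm, (zero_smul F w).symm⟩
  rw [hmk hw, hmk hw']
  exact mk_comb_mem_orbit_of_isometryEquiv _ _ γ hγ (map_zero γ)

variable [Finite F]

theorem smul_mem_hermitian_iff (h : IsQuadGen d e) (γ : groupG K Q) (P : ℙ K (Fin n → K)) :
    γ • P ∈ hermitian K Q ↔ P ∈ hermitian K Q :=
  h.smul_mem_iff (fun _ _ => h.mk_mem_hermitian_iff) (fun _ _ hg _ _ =>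
    apply_mulVec_eq_mul_iff hg) γ P

theorem smul_mem_setO_iff (h : IsQuadGen d e) (γ : groupG K Q) (P : ℙ K (Fin n → K)) :
    γ • P ∈ setO K Q ↔ P ∈ setO K Q :=
  h.smul_mem_iff (fun _ _ => h.mk_mem_setO_iff) (fun g _ hg _ _ => by
    rw [apply_mulVec_eq_mul_iff hg, linearIndependent_mulVec_pair_iff g,
      disc_mulVec_eq_zero_iff hg]) γ P

theorem smul_mem_setE_iff (h : IsQuadGen d e) (γ : groupG K Q) (P : ℙ K (Fin n → K)) :
    γ • P ∈ setE K Q ↔ P ∈ setE K Q :=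
  h.smul_mem_iff (fun _ _ => h.mk_mem_setE_iff) (fun _ _ hg _ _ => by
    rw [apply_mulVec_eq_mul_iff hg, isSquare_disc_mulVec_iff hg]) γ P

theorem smul_mem_setS_iff (h : IsQuadGen d e) (γ : groupG K Q) (P : ℙ K (Fin n → K)) :
    γ • P ∈ setS K Q ↔ P ∈ setS K Q :=
  h.smul_mem_iff (fun _ _ => h.mk_mem_setS_iff) (fun _ _ hg _ _ => by
    rw [apply_mulVec_eq_mul_iff hg, isSquare_disc_mulVec_iff hg, ne_eq,
      disc_mulVec_eq_zero_iff hg]) γ P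

theorem mem_orbit_of_mem_setO (h : IsQuadGen d e) (hQ : Q.polarBilin.Nondegenerate)
    {P P' : ℙ K (Fin n → K)} (hP : P ∈ setO K Q) (hP' : P' ∈ setO K Q) :
    P' ∈ MulAction.orbit (groupG K Q) P := by
  induction P using h.induction_comb with | hp u v hx => ?_
  induction P' using h.induction_comb with | hp u' v' hx' => ?_
  obtain ⟨hq, hi, hd⟩ := (h.mk_mem_setO_iff hx).1 hP
  obtain ⟨hq', hi', hd'⟩ := (h.mk_mem_setO_iff hx').1 hP'
  obtain ⟨hu, hv, hb⟩ := eq_zero_of_disc_eq_zero h.two_ne_zero h.not_isSquare hq hd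
  obtain ⟨hu', hv', hb'⟩ := eq_zero_of_disc_eq_zero h.two_ne_zero h.not_isSquare hq' hd'
  obtain ⟨γ, hγu, hγv⟩ := exists_isometryEquiv_apply_pair_eq h.two_ne_zero hQ hi hi'
    (hu.trans hu'.symm) (hv.trans hv'.symm) (hb.trans hb'.symm)
  exact mk_comb_mem_orbit_of_isometryEquiv _ _ γ hγu hγv

theorem polarExt_comb_self_ne_zero (h : IsQuadGen d e) (huv : Q u = d * Q v)
    (hd : disc Q u v ≠ 0) : polarExt K Q (comb e u v) (comb e u v) ≠ 0 := by
  intro h0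
  have h00 : polarExt K Q (comb e u v) (comb e u v) =
      polarExt K Q (comb e (0 : Fin n → F) 0) (comb e (0 : Fin n → F) 0) := by
    rw [h0, comb_zero, map_zero, map_zero]
  obtain ⟨hv, hb⟩ := (h.polarExt_comb_self_eq_iff huv (by simp)).1 h00
  exact hd (by simp [disc, hb, hv])

theorem exists_smul_polarExt_eq (h : IsQuadGen d e) (huv : Q u = d * Q v)
    (huv' : Q u' = d * Q v') (hd : disc Q u v ≠ 0) (hd' : disc Q u' v' ≠ 0)
    (hs : IsSquare (disc Q u v) ↔ IsSquare (disc Q u' v')) :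
    ∃ z : K, z ≠ 0 ∧ polarExt K Q (z • comb e u v) (z • comb e u v) =
      polarExt K Q (comb e u' v') (comb e u' v') := by
  have := h.finite
  have hb := h.polarExt_comb_self_ne_zero huv hd
  have hb' := h.polarExt_comb_self_ne_zero huv' hd'
  rw [← h.isSquare_two_mul_polarExt_comb_self_iff huv,
    ← h.isSquare_two_mul_polarExt_comb_self_iff huv'] at hs
  set b := polarExt K Q (comb e u v) (comb e u v)
  set b' := polarExt K Q (comb e u' v') (comb e u' v')
  have h2e : 2 * e ≠ 0 := by
    intro h0
    refine h.two_ne_zero (h.algebraMap_add_mul_eq_zero (a := 0) ?_).2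
    rw [map_zero, zero_add, map_ofNat, mul_comm, h0]
  obtain ⟨s, hs⟩ : IsSquare (b * b') := by
    have := isSquare_mul_of_isSquare_iff hs
    rwa [show 2 * e * b * (2 * e * b') = (2 * e) ^ 2 * (b * b') by ring,
      isSquare_sq_mul_iff h2e] at this
  have hs0 : s ≠ 0 := by
    rintro rfl
    exact mul_ne_zero hb hb' (by rw [hs, mul_zero])
  refine ⟨s / b, div_ne_zero hs0 hb, ?_⟩
  rw [map_smul, map_smul, LinearMap.smul_apply, smul_eq_mul, smul_eq_mul]
  change s / b * (s / b * b) = b'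
  rw [div_mul_cancel₀ s hb, div_mul_eq_mul_div, ← hs, mul_div_cancel_left₀ b' hb]

theorem mem_orbit_of_disc_ne_zero (h : IsQuadGen d e) (hQ : Q.polarBilin.Nondegenerate)
    (hx : comb e u v ≠ 0) (hx' : comb e u' v' ≠ 0) (huv : Q u = d * Q v) (huv' : Q u' = d * Q v')
    (hd : disc Q u v ≠ 0) (hd' : disc Q u' v' ≠ 0)
    (hs : IsSquare (disc Q u v) ↔ IsSquare (disc Q u' v')) :
    Projectivization.mk K _ hx' ∈ MulAction.orbit (groupG K Q) (Projectivization.mk K _ hx) := by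
  obtain ⟨z, hz, hb⟩ := h.exists_smul_polarExt_eq huv huv' hd hd' hs
  obtain ⟨u₁, v₁, hz₁⟩ := h.exists_comb_eq (z • comb e u v)
  have hx₁ : comb e u₁ v₁ ≠ 0 := hz₁ ▸ smul_ne_zero hz hx
  have hmk : Projectivization.mk K _ hx₁ = Projectivization.mk K _ hx :=
    (Projectivization.mk_eq_mk_iff' ..).2 ⟨z, hz₁.symm⟩
  have huv₁ : Q u₁ = d * Q v₁ := by
    rwa [← h.mk_mem_hermitian_iff hx₁, hmk, h.mk_mem_hermitian_iff]
  rw [← hz₁] at hb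
  obtain ⟨hv, hpolar⟩ := (h.polarExt_comb_self_eq_iff huv₁ huv').1 hb
  have hu : Q u₁ = Q u' := by rw [huv₁, huv', hv]
  have hd₁ : disc Q u₁ v₁ ≠ 0 := by rwa [disc, hu, hv, hpolar]
  obtain ⟨γ, hγu, hγv⟩ := exists_isometryEquiv_apply_pair_eq h.two_ne_zero hQ
    (linearIndependent_of_disc_ne_zero hd₁) (linearIndependent_of_disc_ne_zero hd') hu hv hpolar
  rw [← hmk]
  exact mk_comb_mem_orbit_of_isometryEquiv _ _ γ hγu hγv

theorem mem_orbit_of_mem_setE (h : IsQuadGen d e) (hQ : Q.polarBilin.Nondegenerate)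
    {P P' : ℙ K (Fin n → K)} (hP : P ∈ setE K Q) (hP' : P' ∈ setE K Q) :
    P' ∈ MulAction.orbit (groupG K Q) P := by
  induction P using h.induction_comb with | hp u v hx => ?_
  induction P' using h.induction_comb with | hp u' v' hx' => ?_
  obtain ⟨hq, hs⟩ := (h.mk_mem_setE_iff hx).1 hP
  obtain ⟨hq', hs'⟩ := (h.mk_mem_setE_iff hx').1 hP'
  exact h.mem_orbit_of_disc_ne_zero hQ hx hx' hq hq' (ne_zero_of_not_isSquare hs)
    (ne_zero_of_not_isSquare hs') (iff_of_false hs hs')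

theorem mem_orbit_of_mem_setS (h : IsQuadGen d e) (hQ : Q.polarBilin.Nondegenerate)
    {P P' : ℙ K (Fin n → K)} (hP : P ∈ setS K Q) (hP' : P' ∈ setS K Q) :
    P' ∈ MulAction.orbit (groupG K Q) P := by
  induction P using h.induction_comb with | hp u v hx => ?_
  induction P' using h.induction_comb with | hp u' v' hx' => ?_
  obtain ⟨hq, hs, hd⟩ := (h.mk_mem_setS_iff hx).1 hP
  obtain ⟨hq', hs', hd'⟩ := (h.mk_mem_setS_iff hx').1 hP'
  exact h.mem_orbit_of_disc_ne_zero hQ hx hx' hq hq' hd hd' (iff_of_true hs hs')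

end IsQuadGen

variable (K Q) in
/-- The four classes of points of the Hermitian variety. -/
def pointClasses : Set (Set (ℙ K (Fin n → K))) := {setQ K Q, setO K Q, setE K Q, setS K Q}

namespace IsQuadGen

variable [Finite F]

theorem sUnion_pointClasses (h : IsQuadGen d e) : ⋃₀ pointClasses K Q = hermitian K Q := by
  ext P
  induction P using h.induction_comb with | hp u v hx => ?_
  simp only [pointClasses, Set.sUnion_insert, Set.sUnion_singleton, Set.mem_union,
    h.mk_mem_hermitian_iff, h.mk_mem_setQ_iff, h.mk_mem_setO_iff, h.mk_mem_setE_iff,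
    h.mk_mem_setS_iff]
  tauto

theorem pairwise_disjoint_pointClasses (h : IsQuadGen d e) :
    [setQ K Q, setO K Q, setE K Q, setS K Q].Pairwise Disjoint := by
  simp only [List.pairwise_cons, List.mem_cons, List.not_mem_nil, forall_eq_or_imp, or_false,
    forall_eq, IsEmpty.forall_iff, implies_true, List.Pairwise.nil, and_true,
    Set.disjoint_left, ← forall_and]
  intro P
  induction P using h.induction_comb with | hp u v hx => ?_
  simp only [h.mk_mem_setQ_iff, h.mk_mem_setO_iff, h.mk_mem_setE_iff, h.mk_mem_setS_iff]
  have hli := linearIndependent_of_disc_ne_zero (Q := Q) (u := u) (v := v)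
  have hsq : disc Q u v = 0 → IsSquare (disc Q u v) := fun h0 => h0 ▸ .zero
  tauto

theorem ncard_pointClasses (h : IsQuadGen d e) (hne : ∀ X ∈ pointClasses K Q, X.Nonempty) :
    (pointClasses K Q).ncard = 4 := by
  classical
  have hnodup : [setQ K Q, setO K Q, setE K Q, setS K Q].Nodup :=
    h.pairwise_disjoint_pointClasses.imp_of_mem fun hX _ hXY =>
      hXY.ne (hne _ (by simpa [pointClasses] using hX)).ne_empty
  have hset : pointClasses K Q =
      ([setQ K Q, setO K Q, setE K Q, setS K Q].toFinset : Set (Set (ℙ K (Fin n → K)))) := by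
    simp [pointClasses]
  rw [hset, Set.ncard_coe_finset, List.toFinset_card_of_nodup hnodup]
  rfl

theorem orbit_eq_of_mem_pointClasses (h : IsQuadGen d e) (hQ : Q.polarBilin.Nondegenerate)
    {X : Set (ℙ K (Fin n → K))} (hX : X ∈ pointClasses K Q) {P : ℙ K (Fin n → K)} (hP : P ∈ X) :
    MulAction.orbit (groupG K Q) P = X := by
  refine Set.Subset.antisymm ?_ fun P' hP' => ?_
  · rintro _ ⟨γ, rfl⟩
    rcases hX with rfl | rfl | rfl | rfl
    · exact (h.smul_mem_setQ_iff γ P).2 hP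
    · exact (h.smul_mem_setO_iff γ P).2 hP
    · exact (h.smul_mem_setE_iff γ P).2 hP
    · exact (h.smul_mem_setS_iff γ P).2 hP
  · rcases hX with rfl | rfl | rfl | rfl
    · exact h.mem_orbit_of_mem_setQ h.two_ne_zero hQ hP hP'
    · exact h.mem_orbit_of_mem_setO hQ hP hP'
    · exact h.mem_orbit_of_mem_setE hQ hP hP'
    · exact h.mem_orbit_of_mem_setS hQ hP hP'

theorem setOf_orbit_hermitian_eq (h : IsQuadGen d e) (hQ : Q.polarBilin.Nondegenerate)
    (hne : ∀ X ∈ pointClasses K Q, X.Nonempty) :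
    {X | ∃ P ∈ hermitian K Q, X = MulAction.orbit (groupG K Q) P} = pointClasses K Q := by
  ext X
  rw [Set.mem_ofPred_eq, ← h.sUnion_pointClasses]
  constructor
  · rintro ⟨P, ⟨Y, hY, hP⟩, rfl⟩
    rwa [h.orbit_eq_of_mem_pointClasses hQ hY hP]
  · intro hX
    obtain ⟨P, hP⟩ := hne X hX
    exact ⟨P, ⟨X, hX, hP⟩, (h.orbit_eq_of_mem_pointClasses hQ hX hP).symm⟩

end IsQuadGen

end Orbits

section IsotropicPairs

open QuadraticMap

variable {F V : Type*} [Field F] [AddCommGroup V] [Module F V] {Q : QuadraticForm F V} {u : V}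

theorem natCard_mul_natCard_fiber {f : V →ₗ[F] F} (hf : f ≠ 0) (m : F) :
    Nat.card F * Nat.card {v // f v = m} = Nat.card V := by
  obtain ⟨y, hy⟩ : ∃ y, f y = 1 := LinearMap.surjective hf 1
  rw [← Nat.card_prod]
  exact Nat.card_congr
    { toFun p := p.2 + p.1 • y
      invFun w := (f w - m, ⟨w - (f w - m) • y, by simp [hy]⟩)
      left_inv := by
        rintro ⟨t, v, rfl⟩
        simp [hy]
      right_inv w := by simp }

theorem apply_sub_div_smul_of_isotropic (hu : Q u = 0) {m : F} (hm : m ≠ 0) {w : V}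
    (hw : polar Q u w = m) : Q (w - (Q w / m) • u) = 0 := by
  rw [sub_eq_add_neg, ← neg_smul, apply_add_smul_of_isotropic hu, polar_comm, hw, neg_mul,
    div_mul_cancel₀ _ hm, add_neg_cancel]

theorem polar_add_smul_self_of_isotropic (hu : Q u = 0) (v : V) (a : F) :
    polar Q u (v + a • u) = polar Q u v := by
  simp [polar_add_right, polar_smul_right, polar_self, hu]

theorem natCard_mul_natCard_isotropic_polar_eq_of_ne_zero (hu : Q u = 0) {m : F} (hm : m ≠ 0) :
    Nat.card F * Nat.card {v // Q v = 0 ∧ polar Q u v = m} =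
      Nat.card {v // polar Q u v = m} := by
  have hpolar (v : V) (a : F) : polar Q u (v - a • u) = polar Q u v := by
    rw [sub_eq_add_neg, ← neg_smul, polar_add_smul_self_of_isotropic hu]
  rw [← Nat.card_prod]
  exact Nat.card_congr
    { toFun p := ⟨p.2 + p.1 • u, by rw [polar_add_smul_self_of_isotropic hu, p.2.2.2]⟩
      invFun w := (Q w / m, ⟨w - (Q w / m) • u,
        apply_sub_div_smul_of_isotropic hu hm w.2, (hpolar _ _).trans w.2⟩)
      left_inv := by
        rintro ⟨t, v, hv, rfl⟩
        have ht : Q (v + t • u) / polar Q u v = t := by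
          rw [apply_add_smul_of_isotropic hu, hv, zero_add, polar_comm, mul_div_cancel_right₀ _ hm]
        simp [ht]
      right_inv w := by simp }

theorem polarBilin_apply_ne_zero (hQ : Q.polarBilin.Nondegenerate) (hu : u ≠ 0) :
    Q.polarBilin u ≠ 0 := fun h => hu (hQ.1 u fun v => by rw [h, LinearMap.zero_apply])

variable [Finite F] [FiniteDimensional F V]

theorem natCard_sq_mul_natCard_isotropic_polar_eq (h2 : (2 : F) ≠ 0)
    (hQ : Q.polarBilin.Nondegenerate) (hV : Odd (Module.finrank F V)) (hu0 : u ≠ 0) (hu : Q u = 0)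
    (m : F) : Nat.card F ^ 2 * Nat.card {v // Q v = 0 ∧ polar Q u v = m} = Nat.card V := by
  classical
  have := Fintype.ofFinite F
  have := Module.finite_of_finite F (M := V)
  have hne {m : F} (hm : m ≠ 0) :
      Nat.card F ^ 2 * Nat.card {v // Q v = 0 ∧ polar Q u v = m} = Nat.card V := by
    rw [pow_two, mul_assoc, natCard_mul_natCard_isotropic_polar_eq_of_ne_zero hu hm]
    exact natCard_mul_natCard_fiber (polarBilin_apply_ne_zero hQ hu0) m
  by_cases hm : m = 0
  swap
  · exact hne hm
  subst hm
  have hsum : Nat.card {v // Q v = 0} = ∑ m, Nat.card {v // Q v = 0 ∧ polar Q u v = m} := by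
    rw [← Nat.card_congr (Equiv.sigmaFiberEquiv fun v : {v // Q v = 0} => polar Q u v),
      Nat.card_sigma]
    exact Finset.sum_congr rfl fun m _ => Nat.card_congr (Equiv.subtypeSubtypeEquivSubtypeInter
      (fun v => Q v = 0) fun v => polar Q u v = m)
  have hiso := card_mul_card_isotropic h2 hQ hV
  have htotal : Nat.card F * Nat.card V =
      Nat.card F ^ 2 * Nat.card {v // Q v = 0 ∧ polar Q u v = 0} +
        (Nat.card F - 1) * Nat.card V := by
    rw [← hiso, ← mul_assoc, ← pow_two, hsum, Finset.mul_sum,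
      ← Finset.add_sum_erase _ _ (Finset.mem_univ 0),
      Finset.sum_congr rfl fun m hm => hne (Finset.ne_of_mem_erase hm), Finset.sum_const,
      Finset.card_erase_of_mem (Finset.mem_univ _), Finset.card_univ, smul_eq_mul, ← hsum, hiso,
      Nat.card_eq_fintype_card (α := F)]
  obtain ⟨c, hc⟩ := Nat.exists_eq_succ_of_ne_zero (Nat.card_pos (α := F)).ne'
  rw [hc] at htotal ⊢
  simp only [Nat.succ_eq_add_one, Nat.add_sub_cancel] at htotal ⊢
  linarith

theorem natCard_sq_mul_natCard_isotropic_pairs_add (h2 : (2 : F) ≠ 0)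
    (hQ : Q.polarBilin.Nondegenerate) (hV : Odd (Module.finrank F V)) (m : F) :
    Nat.card F ^ 2 * Nat.card {p : V × V // Q p.1 = 0 ∧ Q p.2 = 0 ∧ polar Q p.1 p.2 = m} +
      Nat.card V = Nat.card F ^ 2 * Nat.card {v // Q v = 0 ∧ 0 = m} +
        Nat.card {v // Q v = 0} * Nat.card V := by
  classical
  have := Module.finite_of_finite F (M := V)
  have := Fintype.ofFinite {v // Q v = 0}
  have hpairs : Nat.card {p : V × V // Q p.1 = 0 ∧ Q p.2 = 0 ∧ polar Q p.1 p.2 = m} =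
      ∑ u : {u // Q u = 0}, Nat.card {v // Q v = 0 ∧ polar Q u v = m} := by
    rw [← Nat.card_sigma]
    exact Nat.card_congr
      { toFun p := ⟨⟨p.1.1, p.2.1⟩, p.1.2, p.2.2⟩
        invFun s := ⟨(s.1, s.2), s.1.2, s.2.2⟩
        left_inv _ := rfl
        right_inv _ := rfl }
  have hzero : (⟨0, map_zero Q⟩ : {u // Q u = 0}) ∈ Finset.univ := Finset.mem_univ _
  have hcard := Finset.card_erase_add_one hzero
  rw [hpairs, Finset.mul_sum, ← Finset.add_sum_erase _ _ hzero,
    Finset.sum_congr rfl fun u hu => natCard_sq_mul_natCard_isotropic_polar_eq h2 hQ hV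
      (fun h0 => Finset.ne_of_mem_erase hu (Subtype.ext h0)) u.2 m,
    Finset.sum_const, smul_eq_mul, Nat.card_eq_fintype_card (α := {v // Q v = 0}),
    ← Finset.card_univ, ← hcard, add_mul, one_mul, add_assoc]
  simp only [polar_zero_left]

theorem natCard_sq_mul_natCard_isotropic_pairs_of_ne_zero_add (h2 : (2 : F) ≠ 0)
    (hQ : Q.polarBilin.Nondegenerate) (hV : Odd (Module.finrank F V)) {m : F} (hm : m ≠ 0) :
    Nat.card F ^ 2 * Nat.card {p : V × V // Q p.1 = 0 ∧ Q p.2 = 0 ∧ polar Q p.1 p.2 = m} +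
      Nat.card V = Nat.card {v // Q v = 0} * Nat.card V := by
  rw [natCard_sq_mul_natCard_isotropic_pairs_add h2 hQ hV]
  simp [hm.symm]

theorem natCard_orthogonal_isotropic_pairs_eq_add (h2 : (2 : F) ≠ 0)
    (hQ : Q.polarBilin.Nondegenerate) (hV : Odd (Module.finrank F V)) :
    Nat.card {p : V × V // Q p.1 = 0 ∧ Q p.2 = 0 ∧ polar Q p.1 p.2 = 0} =
      Nat.card {p : V × V // Q p.1 = 0 ∧ Q p.2 = 0 ∧ polar Q p.1 p.2 = 1} +
        Nat.card {v // Q v = 0} := by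
  have h0 := natCard_sq_mul_natCard_isotropic_pairs_add h2 hQ hV 0
  have h1 := natCard_sq_mul_natCard_isotropic_pairs_of_ne_zero_add h2 hQ hV one_ne_zero
  simp only [and_true] at h0
  have hq : 0 < Nat.card F ^ 2 := pow_pos Nat.card_pos 2
  refine Nat.eq_of_mul_eq_mul_left hq ?_
  linarith

theorem exists_linearIndependent_isotropic_pair_polar_eq_zero (h2 : (2 : F) ≠ 0)
    (hQ : Q.polarBilin.Nondegenerate) (hV : Odd (Module.finrank F V))
    (hV4 : 4 ≤ Module.finrank F V) :
    ∃ u v : V, LinearIndependent F ![u, v] ∧ Q u = 0 ∧ Q v = 0 ∧ polar Q u v = 0 := by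
  have := Module.finite_of_finite F (M := V)
  have hq : 1 < Nat.card F := Finite.one_lt_card
  have hpow : Nat.card V = Nat.card F ^ Module.finrank F V := Module.natCard_eq_pow_finrank
  have hiso : Nat.card F ^ 1 < Nat.card F * Nat.card {v // Q v = 0} := by
    rw [card_mul_card_isotropic h2 hQ hV, hpow]
    exact Nat.pow_lt_pow_right hq (by lia)
  have : Nontrivial {v // Q v = 0} := Finite.one_lt_card_iff_nontrivial.1 (by
    rw [pow_one] at hiso
    exact (lt_mul_iff_one_lt_right Nat.card_pos).1 hiso)
  obtain ⟨⟨u, hu⟩, hu0⟩ := exists_ne (⟨0, map_zero Q⟩ : {v // Q v = 0})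
  have hu0 : u ≠ 0 := fun h0 => hu0 (Subtype.ext h0)
  have hspan : (F ∙ u : Set V).ncard = Nat.card F := by
    rw [← Nat.card_coe_set_eq, SetLike.coe_sort_coe, Module.natCard_eq_pow_finrank (K := F),
      finrank_span_singleton hu0, pow_one]
  obtain ⟨v, ⟨hv, huv⟩, hvu⟩ := Set.exists_mem_notMem_of_ncard_lt_ncard
    (s := (F ∙ u : Set V)) (t := {v | Q v = 0 ∧ polar Q u v = 0}) (by
      rw [hspan]
      refine lt_of_mul_lt_mul_left (a := Nat.card F ^ 2) ?_ (Nat.zero_le _)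
      rw [← Nat.card_coe_set_eq]
      refine lt_of_lt_of_eq ?_
        (natCard_sq_mul_natCard_isotropic_polar_eq h2 hQ hV hu0 hu 0).symm
      rw [← pow_succ, hpow]
      exact Nat.pow_lt_pow_right hq hV4)
  exact ⟨u, v, (LinearIndependent.pair_iff' hu0).2 fun a ha =>
    hvu (Submodule.mem_span_singleton.2 ⟨a, ha⟩), hu, hv, huv⟩

end IsotropicPairs

section PointCounts

open QuadraticMap

theorem natCard_subtype_eq_mul_ncard {K V : Type*} [Field K] [AddCommGroup V] [Module K V]
    [Finite V] {p : V → Prop} {X : Set (ℙ K V)} {m : ℕ}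
    (hp : ∀ x, p x → ∃ hx : x ≠ 0, Projectivization.mk K x hx ∈ X)
    (hm : ∀ x (hx : x ≠ 0), Projectivization.mk K x hx ∈ X → Nat.card {z : Kˣ // p (z • x)} = m) :
    Nat.card {x // p x} = m * X.ncard := by
  let φ : (Σ P : X, {z : Kˣ // p (z • P.1.rep)}) → {x // p x} := fun s => ⟨s.2.1 • s.1.1.rep, s.2.2⟩
  have hφ : Function.Bijective φ := by
    constructor
    · rintro ⟨P, z, hz⟩ ⟨P', z', hz'⟩ hzz'
      have heq : z • P.1.rep = z' • P'.1.rep := by simpa [φ] using hzz'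
      obtain rfl : P = P' := Subtype.ext <| by
        rw [← P.1.mk_rep, ← P'.1.mk_rep, Projectivization.mk_eq_mk_iff]
        exact ⟨z⁻¹ * z', by rw [mul_smul, ← heq, inv_smul_smul]⟩
      obtain rfl : z = z' := Units.ext (smul_left_injective K P.1.rep_nonzero heq)
      rfl
    · rintro ⟨x, hpx⟩
      obtain ⟨hx, hxX⟩ := hp x hpx
      obtain ⟨z, hz⟩ := Projectivization.exists_smul_eq_mk_rep K x hx
      have hz' : z⁻¹ • (Projectivization.mk K x hx).rep = x := by rw [← hz, inv_smul_smul]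
      exact ⟨⟨⟨_, hxX⟩, ⟨z⁻¹, by rwa [hz']⟩⟩, Subtype.ext hz'⟩
  have := Finite.of_injective φ hφ.1
  have := Fintype.ofFinite X
  have hfin (P : X) : Finite {z : Kˣ // p (z • P.1.rep)} :=
    Finite.of_injective (Sigma.mk (β := fun P : X => {z : Kˣ // p (z • P.1.rep)}) P)
      sigma_mk_injective
  rw [← Nat.card_eq_of_bijective φ hφ, Nat.card_sigma,
    Finset.sum_congr rfl fun P _ => hm _ P.1.rep_nonzero (by rw [P.1.mk_rep]; exact P.2),
    Finset.sum_const, Finset.card_univ, smul_eq_mul, mul_comm, ← Nat.card_eq_fintype_card,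
    Nat.card_coe_set_eq]

theorem natCard_mk_mem_eq_mul_ncard {K V : Type*} [Field K] [AddCommGroup V] [Module K V]
    [Finite V] (X : Set (ℙ K V)) :
    Nat.card {x // ∃ hx : x ≠ 0, Projectivization.mk K x hx ∈ X} = Nat.card Kˣ * X.ncard := by
  refine natCard_subtype_eq_mul_ncard (fun _ => id) fun x hx hX =>
    Nat.card_congr (Equiv.subtypeUnivEquiv fun z => ⟨(smul_ne_zero_iff_ne z).2 hx, ?_⟩)
  rwa [(Projectivization.mk_eq_mk_iff K _ _ _ hx).2 ⟨z, rfl⟩]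

theorem natCard_units_sq_mul_eq {K : Type*} [Field K] (h2 : (2 : K) ≠ 0) {b c : K} (hb : b ≠ 0)
    (hc : c ≠ 0) (hbc : IsSquare (c * b)) : Nat.card {z : Kˣ // (z : K) ^ 2 * b = c} = 2 := by
  obtain ⟨s, hs⟩ := hbc
  have hs0 : s ≠ 0 := by
    rintro rfl
    exact mul_ne_zero hc hb (hs.trans (mul_zero 0))
  let z : Kˣ := Units.mk0 (s / b) (div_ne_zero hs0 hb)
  have hzb : (z : K) ^ 2 * b = c := by
    rw [Units.val_mk0]
    field_simp
    linear_combination -hs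
  have hset : {w : Kˣ | (w : K) ^ 2 * b = c} = {z, -z} := by
    ext w
    rw [Set.mem_ofPred_eq, ← hzb, mul_left_inj' hb, sq_eq_sq_iff_eq_or_eq_neg, ← Units.val_neg,
      Units.val_inj, Units.val_inj, Set.mem_insert_iff, Set.mem_singleton_iff]
  have hne : z ≠ -z := fun hz => mul_ne_zero h2 z.ne_zero (by
    have hz' : (z : K) = -z := congrArg Units.val hz
    linear_combination hz')
  exact (Nat.card_coe_set_eq {w : Kˣ | (w : K) ^ 2 * b = c}).trans
    (by rw [hset, Set.ncard_pair hne])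

section Pairs

variable {F V : Type*} [Field F] [AddCommGroup V] [Module F V] {Q : QuadraticForm F V} {d : F}
  [Finite F] [FiniteDimensional F V]

theorem natCard_pairs_eq_mul_eq_add (h2 : (2 : F) ≠ 0) (hd : ¬IsSquare d) :
    Nat.card {p : V × V // Q p.1 = d * Q p.2} =
      Nat.card {p : V × V // Q p.1 = 0 ∧ Q p.2 = 0 ∧ polar Q p.1 p.2 = 0} +
        Nat.card {p : V × V // Q p.1 = d * Q p.2 ∧ disc Q p.1 p.2 ≠ 0} := by
  have := Module.finite_of_finite F (M := V)
  have hzero (p : V × V) : Q p.1 = 0 ∧ Q p.2 = 0 ∧ polar Q p.1 p.2 = 0 ↔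
      Q p.1 = d * Q p.2 ∧ disc Q p.1 p.2 = 0 := by
    refine ⟨fun ⟨hu, hv, huv⟩ => ?_, fun ⟨huv, h⟩ => eq_zero_of_disc_eq_zero h2 hd huv h⟩
    simp [disc, hu, hv, huv]
  simp only [hzero]
  exact (Set.ncard_inter_add_ncard_sdiff_eq_ncard {p : V × V | Q p.1 = d * Q p.2}
    {p | disc Q p.1 p.2 = 0} (Set.toFinite _)).symm

theorem natCard_pairs_disc_ne_zero (h2 : (2 : F) ≠ 0) (hQ : Q.polarBilin.Nondegenerate)
    (hV : Odd (Module.finrank F V)) (hd : ¬IsSquare d) :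
    Nat.card {p : V × V // Q p.1 = d * Q p.2 ∧ disc Q p.1 p.2 ≠ 0} = (Nat.card F ^ 2 - 1) *
      Nat.card {p : V × V // Q p.1 = 0 ∧ Q p.2 = 0 ∧ polar Q p.1 p.2 = 1} := by
  have hq : 0 < Nat.card F := Nat.card_pos
  have hiso := card_mul_card_isotropic h2 hQ hV
  have hherm := card_mul_card_pairs_eq_mul_add h2 hQ hV hd
  have hone := natCard_sq_mul_natCard_isotropic_pairs_of_ne_zero_add h2 hQ hV one_ne_zero
  rw [natCard_pairs_eq_mul_eq_add h2 hd, natCard_orthogonal_isotropic_pairs_eq_add h2 hQ hV,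
    Nat.card_units] at hherm
  refine Nat.eq_of_mul_eq_mul_left (pow_pos hq 2) ?_
  zify [Nat.one_le_pow 2 _ hq, Nat.succ_le_of_lt hq] at hiso hherm hone ⊢
  linear_combination (Nat.card F : ℤ) * hherm - (Nat.card F : ℤ) ^ 2 * hone -
    (Nat.card F * Nat.card V + Nat.card F : ℤ) * hiso

end Pairs

namespace IsQuadGen

variable {F K : Type*} [Field F] [Field K] [Algebra F K] {n : ℕ}
  {Q : QuadraticForm F (Fin n → F)} {d : F} {e : K}

theorem natCard_subtype_eq (h : IsQuadGen d e) (p : (Fin n → K) → Prop) :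
    Nat.card {x // p x} = Nat.card {w : (Fin n → F) × (Fin n → F) // p (comb e w.1 w.2)} :=
  (Nat.card_congr <| (Equiv.ofBijective _ (h.comb_bijective n)).subtypeEquiv fun _ => Iff.rfl).symm

variable [Finite F]

theorem comb_ne_zero_of_disc_ne_zero (h : IsQuadGen d e) {u v : Fin n → F} (huv : Q u = d * Q v)
    (hd : disc Q u v ≠ 0) : comb e u v ≠ 0 := fun h0 =>
  h.polarExt_comb_self_ne_zero huv hd (by rw [h0, map_zero])

theorem hermForm_eq_zero_and_polarExt_eq_iff (h : IsQuadGen d e) {u v : Fin n → F} :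
    hermForm K Q (comb e u v) (comb e u v) = 0 ∧ polarExt K Q (comb e u v) (comb e u v) = 2 * e ↔
      Q u = 0 ∧ Q v = 0 ∧ polar Q u v = 1 := by
  have he : 2 * e = algebraMap F K 0 + e * algebraMap F K 2 := by
    rw [map_zero, map_ofNat, zero_add, mul_comm]
  rw [h.hermForm_comb_self_eq_zero_iff, h.polarExt_comb_self, he,
    h.bijective.1.eq_iff' (a := (_, _)) (b := (_, _)) rfl, Prod.mk.injEq,
    mul_eq_zero_iff_left h.two_ne_zero, mul_eq_left₀ h.two_ne_zero]
  refine ⟨fun ⟨huv, h0, h1⟩ => ?_, fun ⟨hu, hv, h1⟩ => by simp [hu, hv, h1]⟩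
  have hu : Q u = 0 := (mul_eq_zero_iff_left h.two_ne_zero).1 (by linear_combination h0 + huv)
  exact ⟨hu, (mul_eq_zero_iff_left h.ne_zero).1 (huv.symm.trans hu), h1⟩

theorem natCard_polarExt_smul_eq (h : IsQuadGen d e) {x : Fin n → K} (hx : x ≠ 0)
    (hS : Projectivization.mk K x hx ∈ setS K Q) :
    Nat.card {z : Kˣ // hermForm K Q (z • x) (z • x) = 0 ∧
      polarExt K Q (z • x) (z • x) = 2 * e} = 2 := by
  obtain ⟨u, v, rfl⟩ := h.exists_comb_eq x
  obtain ⟨huv, hsq, hd⟩ := (h.mk_mem_setS_iff hx).1 hS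
  have hherm (z : Kˣ) : hermForm K Q (z • comb e u v) (z • comb e u v) = 0 := by
    rw [← mk_mem_hermitian_iff_hermForm_eq_zero ((smul_ne_zero_iff_ne z).2 hx),
      (Projectivization.mk_eq_mk_iff K _ _ _ hx).2 ⟨z, rfl⟩]
    exact (h.mk_mem_hermitian_iff hx).2 huv
  rw [← natCard_units_sq_mul_eq (left_ne_zero_of_mul h.two_mul_ne_zero)
    (h.polarExt_comb_self_ne_zero huv hd) h.two_mul_ne_zero
    ((h.isSquare_two_mul_polarExt_comb_self_iff huv).2 hsq)]
  simp only [hherm, true_and]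
  simp only [Units.smul_def, map_smul, LinearMap.smul_apply, smul_eq_mul,
    ← mul_assoc, pow_two]

theorem natCard_isotropic_pairs_eq_two_mul_ncard_setS (h : IsQuadGen d e) :
    Nat.card {p : (Fin n → F) × (Fin n → F) // Q p.1 = 0 ∧ Q p.2 = 0 ∧ polar Q p.1 p.2 = 1} =
      2 * (setS K Q).ncard := by
  have := h.finite
  simp only [← h.hermForm_eq_zero_and_polarExt_eq_iff]
  rw [← h.natCard_subtype_eq fun x => hermForm K Q x x = 0 ∧ polarExt K Q x x = 2 * e]
  refine natCard_subtype_eq_mul_ncard (fun x hx => ?_) fun x hx => h.natCard_polarExt_smul_eq hx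
  obtain ⟨u, v, rfl⟩ := h.exists_comb_eq x
  obtain ⟨hu, hv, h1⟩ := h.hermForm_eq_zero_and_polarExt_eq_iff.1 hx
  have hdisc : disc Q u v = 1 := by simp [disc, hu, hv, h1]
  have hx0 : comb e u v ≠ 0 := h.comb_ne_zero_of_disc_ne_zero (Q := Q) (by simp [hu, hv])
    (by simp [hdisc])
  exact ⟨hx0, (h.mk_mem_setS_iff hx0).2 (by simp [hdisc, hu, hv])⟩

theorem ncard_setE_union_setS (h : IsQuadGen d e) (hQ : Q.polarBilin.Nondegenerate)
    (hn : Odd n) : (setE K Q ∪ setS K Q).ncard =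
      Nat.card {p : (Fin n → F) × (Fin n → F) // Q p.1 = 0 ∧ Q p.2 = 0 ∧ polar Q p.1 p.2 = 1} := by
  have := h.finite
  have hpairs (p : (Fin n → F) × (Fin n → F)) :
      (∃ hx : comb e p.1 p.2 ≠ 0, Projectivization.mk K _ hx ∈ setE K Q ∪ setS K Q) ↔
        Q p.1 = d * Q p.2 ∧ disc Q p.1 p.2 ≠ 0 := by
    simp only [Set.mem_union, h.mk_mem_setE_iff, h.mk_mem_setS_iff, ← and_or_left, exists_prop]
    have hne := h.comb_ne_zero_of_disc_ne_zero (Q := Q) (u := p.1) (v := p.2)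
    have hsq : disc Q p.1 p.2 = 0 → IsSquare (disc Q p.1 p.2) := fun h0 => h0 ▸ .zero
    tauto
  have hK : Nat.card Kˣ = Nat.card F ^ 2 - 1 := by rw [Nat.card_units, h.natCard_eq]
  have hcard := natCard_mk_mem_eq_mul_ncard (setE K Q ∪ setS K Q)
  rw [h.natCard_subtype_eq] at hcard
  simp only [hpairs] at hcard
  rw [natCard_pairs_disc_ne_zero h.two_ne_zero hQ (by simpa using hn) h.not_isSquare, ← hK] at hcard
  exact (Nat.eq_of_mul_eq_mul_left Nat.card_pos hcard).symm

theorem ncard_setE_eq_ncard_setS (h : IsQuadGen d e) (hQ : Q.polarBilin.Nondegenerate)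
    (hn : Odd n) : (setE K Q).ncard = (setS K Q).ncard := by
  have := h.finite
  have hunion := h.ncard_setE_union_setS (K := K) hQ hn
  rw [h.natCard_isotropic_pairs_eq_two_mul_ncard_setS (K := K), Set.ncard_union_eq] at hunion
  · lia
  · exact List.rel_of_pairwise_cons (List.Pairwise.of_cons (List.Pairwise.of_cons
      h.pairwise_disjoint_pointClasses)) (List.mem_singleton_self _)

theorem two_mul_ncard_setS (h : IsQuadGen d e) {r : ℕ} (hr : Even r) (hr0 : r ≠ 0)
    {Q : QuadraticForm F (Fin (r + 1) → F)} (hQ : Q.polarBilin.Nondegenerate) :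
    2 * (setS K Q).ncard = (Nat.card F ^ r - 1) * Nat.card F ^ (r - 1) := by
  have hq : 0 < Nat.card F := Nat.card_pos
  have hV : Odd (Module.finrank F (Fin (r + 1) → F)) := by simpa using hr.add_one
  have hN : Nat.card (Fin (r + 1) → F) = Nat.card F ^ (r + 1) := by simp [Nat.card_fun]
  have hiso : Nat.card {v // Q v = 0} = Nat.card F ^ r := by
    refine Nat.eq_of_mul_eq_mul_left hq ?_
    rw [card_mul_card_isotropic h.two_ne_zero hQ hV, hN, pow_succ']
  have hpairs := natCard_sq_mul_natCard_isotropic_pairs_of_ne_zero_add h.two_ne_zero hQ hV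
    one_ne_zero
  rw [h.natCard_isotropic_pairs_eq_two_mul_ncard_setS (K := K), hiso, hN] at hpairs
  have hr1 : 2 + (r - 1) = r + 1 := by lia
  refine Nat.eq_of_mul_eq_mul_left (pow_pos hq 2) ?_
  rw [Nat.eq_sub_of_add_eq hpairs, mul_left_comm, ← pow_add _ 2, hr1, Nat.sub_mul, one_mul]

theorem two_mul_ncard_setE (h : IsQuadGen d e) {r : ℕ} (hr : Even r) (hr0 : r ≠ 0)
    {Q : QuadraticForm F (Fin (r + 1) → F)} (hQ : Q.polarBilin.Nondegenerate) :
    2 * (setE K Q).ncard = (Nat.card F ^ r - 1) * Nat.card F ^ (r - 1) := by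
  rw [h.ncard_setE_eq_ncard_setS hQ hr.add_one, h.two_mul_ncard_setS hr hr0 hQ]

theorem nonempty_of_mem_pointClasses (h : IsQuadGen d e) {r : ℕ} (hr : Even r) (hr4 : 4 ≤ r)
    {Q : QuadraticForm F (Fin (r + 1) → F)} (hQ : Q.polarBilin.Nondegenerate)
    {X : Set (ℙ K (Fin (r + 1) → K))} (hX : X ∈ pointClasses K Q) : X.Nonempty := by
  have hpos : 0 < (Nat.card F ^ r - 1) * Nat.card F ^ (r - 1) :=
    Nat.mul_pos (Nat.sub_pos_of_lt (Nat.one_lt_pow (by lia) Finite.one_lt_card))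
      (pow_pos Nat.card_pos _)
  have hV : Module.finrank F (Fin (r + 1) → F) = r + 1 := Module.finrank_fin_fun F
  obtain ⟨u, v, huv, hu, hv, hp⟩ := exists_linearIndependent_isotropic_pair_polar_eq_zero
    h.two_ne_zero hQ (by rw [hV]; exact hr.add_one) (by lia)
  have hcomb {w : Fin (r + 1) → F} : comb e u w ≠ 0 := fun h0 =>
    huv.ne_zero 0 (congrArg Prod.fst ((h.comb_bijective _).1 (a₁ := (u, w)) (a₂ := 0)
      (h0.trans (by simp [comb_zero]))))
  rcases hX with rfl | rfl | rfl | rfl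
  · exact ⟨_, (h.mk_mem_setQ_iff (hcomb (w := 0))).2
      ⟨by simp [hu], fun hi => hi.ne_zero 1 rfl⟩⟩
  · exact ⟨_, (h.mk_mem_setO_iff (hcomb (w := v))).2 ⟨by simp [hu, hv], huv, by simp [disc, *]⟩⟩
  · have hE := h.two_mul_ncard_setE hr (by lia) hQ
    exact Set.nonempty_of_ncard_ne_zero (by lia)
  · have hS := h.two_mul_ncard_setS hr (by lia) hQ
    exact Set.nonempty_of_ncard_ne_zero (by lia)

end IsQuadGen

end PointCounts

end ParabolicHermitian

theorem mainTheorem8 {F : Type*} {K : Type*} [Field F] [Finite F] [Field K] [Algebra F K]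
    (q r : ℕ) (hF : Nat.card F = q) (hK : Nat.card K = q ^ 2) (hq : Odd q)
    (hr : 4 ≤ r) (hr' : Even r)
    (Q : QuadraticForm F (Fin (r + 1) → F)) (hQ : Q.polarBilin.Nondegenerate) :
    (∀ g ∈ ParabolicHermitian.groupG K Q, ∀ P ∈ ParabolicHermitian.hermitian K Q,
      g • P ∈ ParabolicHermitian.hermitian K Q) ∧
    {X : Set (ℙ K (Fin (r + 1) → K)) | ∃ P ∈ ParabolicHermitian.hermitian K Q,
        X = MulAction.orbit (ParabolicHermitian.groupG K Q) P} =
      {ParabolicHermitian.setQ K Q, ParabolicHermitian.setO K Q,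
        ParabolicHermitian.setE K Q, ParabolicHermitian.setS K Q} ∧
    ({ParabolicHermitian.setQ K Q, ParabolicHermitian.setO K Q,
        ParabolicHermitian.setE K Q, ParabolicHermitian.setS K Q} :
      Set (Set (ℙ K (Fin (r + 1) → K)))).ncard = 4 ∧
    ((ParabolicHermitian.setS K Q).ncard : ℚ) = (q : ℚ) ^ (r - 1) * ((q : ℚ) ^ r - 1) / 2 ∧
    ((ParabolicHermitian.setE K Q).ncard : ℚ) = (q : ℚ) ^ (r - 1) * ((q : ℚ) ^ r - 1) / 2 := by
  subst hF
  obtain ⟨d, e, h⟩ := ParabolicHermitian.exists_isQuadGen_of_natCard_eq hq hK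
  have hne := fun X hX => h.nonempty_of_mem_pointClasses (X := X) hr' hr hQ hX
  have hcast {N : ℕ} (hN : 2 * N = (Nat.card F ^ r - 1) * Nat.card F ^ (r - 1)) :
      (N : ℚ) = (Nat.card F : ℚ) ^ (r - 1) * ((Nat.card F : ℚ) ^ r - 1) / 2 := by
    have hN' := congrArg (Nat.cast : ℕ → ℚ) hN
    push_cast [Nat.one_le_pow r _ Nat.card_pos] at hN'
    linear_combination hN' / 2
  exact ⟨fun g hg P hP => (h.smul_mem_hermitian_iff ⟨g, hg⟩ P).2 hP,
    h.setOf_orbit_hermitian_eq hQ hne, h.ncard_pointClasses hne,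
    hcast (h.two_mul_ncard_setS hr' (by lia) hQ), hcast (h.two_mul_ncard_setE hr' (by lia) hQ)⟩
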